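/- **Lemma (no index $0$ discs for $\mathbb F_4$).** Let $D^2\subset\mathbb C$ be the closed unit disc and $\mathbb P^1=\mathbb C\cup\{\infty\}$. Let $\epsilon\in\mathbb C$ and $r,\lambda\in\mathbb R$ with $0<r<|\epsilon|$, and let $\Delta=\{z\in\mathbb C: |z-\epsilon|\le r\}$, a closed disc that contains neither $0$ nor $\infty$. Maps on $D^2$ are taken to be continuous on $D^2$ and holomorphic in the interior. (1) Let $m\ge 1$ be an integer. There is no meromorphic function $\bar u$ on $D^2$, that is, no map $\bar u:D^2\to\mathbb P^1$ as above, with $\bar u(D^2)\subset\mathbb P^1\setminus\operatorname{int}\Delta$ and $\bar u(\partial D^2)\subset\partial\Delta$, that has exactly $m$ double zeros and $m$ double poles and no other zeros or poles. Here double zeros (poles) may coincide: a zero (pole) of order $2k$ counts as $k$ double zeros (poles). (2) The chosen perturbation of the Hirzebruch surface $\mathbb F_4$ is the complex manifold $\mathbb P^1\times\mathbb P^1$ with coordinates $(z_1,z_2)$, with the tori $$T_{r,\lambda}=\{(z_1,z_2)\in\mathbb C\times\mathbb C:\ |z_1^2z_2-\epsilon|=r,\ |z_1|^4-|z_2|^2=\lambda\}.$$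 It has no index $0$ discs: there is no nonconstant holomorphic disc $u:(D^2,\partial D^2)\to(\mathbb P^1\times\mathbb P^1,T_{r,\lambda})$ of Maslov index $0$. (3) Hence there are no walls: for every $\epsilon\ne0$, the set of those $(r,\lambda)$ with $0<r<|\epsilon|$ for which $T_{r,\lambda}$ bounds a nonconstant holomorphic disc of Maslov index $0$ is empty. -/

import Mathlib

open Set Filter Topology

noncomputable section

/-- The complex projective line `ℙ¹ = ℂ ∪ {∞}`. -/
abbrev P1 : Type := OnePoint ℂ

namespace P1

/-- The point `[p : q]` of `ℙ¹` in homogeneous coordinates, for `(p, q) ≠ (0, 0)`; the affine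
coordinate is `p / q`. -/
def ofHom (p q : ℂ) : P1 :=
  open Classical in if q = 0 then OnePoint.infty else ((p / q : ℂ) : P1)

/-- The affine coordinate `z`, centred at `0`; it is meaningful away from `∞`. -/
def coordZero : P1 → ℂ
  | OnePoint.infty => 0
  | OnePoint.some z => z

/-- The affine coordinate `1 / z`, centred at `∞`; it is meaningful away from `0`. -/
def coordInfty : P1 → ℂ
  | OnePoint.infty => 0
  | OnePoint.some z => z⁻¹

/-- A `ℙ¹`-valued map is holomorphic at `a` if near `a` it is given by a holomorphic function
in one of the two standard charts of `ℙ¹`. -/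
def HolomorphicAt (u : ℂ → P1) (a : ℂ) : Prop :=
  (∃ g : ℂ → ℂ, AnalyticAt ℂ g a ∧ ∀ᶠ z in 𝓝 a, u z = ofHom (g z) 1) ∨
    (∃ g : ℂ → ℂ, AnalyticAt ℂ g a ∧ ∀ᶠ z in 𝓝 a, u z = ofHom 1 (g z))

/-- The order of vanishing of a `ℙ¹`-valued holomorphic map at `a` (zero if `u a ≠ 0`). -/
def zeroOrder (u : ℂ → P1) (a : ℂ) : ℕ∞ :=
  open Classical in
    if u a = ((0 : ℂ) : P1) then analyticOrderAt (fun z => coordZero (u z)) a else 0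

/-- The order of the pole of a `ℙ¹`-valued holomorphic map at `a` (zero if `u a ≠ ∞`). -/
def poleOrder (u : ℂ → P1) (a : ℂ) : ℕ∞ :=
  open Classical in
    if u a = OnePoint.infty then analyticOrderAt (fun z => coordInfty (u z)) a else 0

/-- A meromorphic function on the closed unit disc, as a map to `ℙ¹`: continuous on the closed
disc and holomorphic in its interior. Only the values on the closed unit disc matter. -/
def IsMeromorphicDisc (u : ℂ → P1) : Prop :=
  ContinuousOn u (Metric.closedBall 0 1) ∧ ∀ a ∈ Metric.ball (0 : ℂ) 1, HolomorphicAt u a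

/-- `u` maps the pair `(D², ∂D²)` to `(ℙ¹ ∖ int Δ, ∂Δ)`, where `Δ = {|z - ε| ≤ r}`. -/
def MapsToComplementOfDisc (ε : ℂ) (r : ℝ) (u : ℂ → P1) : Prop :=
  (∀ z ∈ Metric.closedBall (0 : ℂ) 1, u z ∉ ((↑) : ℂ → P1) '' Metric.ball ε r) ∧
    ∀ z ∈ Metric.sphere (0 : ℂ) 1, u z ∈ ((↑) : ℂ → P1) '' Metric.sphere ε r

/-- `u` has exactly `m` double zeros `a₁, …, aₘ` in the disc and no others. The `aᵢ` may coincide: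
a zero of order `2k` counts as `k` double zeros. -/
def HasExactlyDoubleZeros (u : ℂ → P1) (m : ℕ) : Prop :=
  ∃ a : Fin m → ℂ, (∀ i, a i ∈ Metric.ball (0 : ℂ) 1) ∧
    ∀ z ∈ Metric.ball (0 : ℂ) 1,
      zeroOrder u z = ((2 * Nat.card {i : Fin m // a i = z} : ℕ) : ℕ∞)

/-- `u` has exactly `m` double poles `b₁, …, bₘ` in the disc and no others. The `bᵢ` may coincide:
a pole of order `2k` counts as `k` double poles. -/
def HasExactlyDoublePoles (u : ℂ → P1) (m : ℕ) : Prop :=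
  ∃ b : Fin m → ℂ, (∀ i, b i ∈ Metric.ball (0 : ℂ) 1) ∧
    ∀ z ∈ Metric.ball (0 : ℂ) 1,
      poleOrder u z = ((2 * Nat.card {i : Fin m // b i = z} : ℕ) : ℕ∞)

/-- A continuous lift of `u` to homogeneous coordinates over the closed unit disc. -/
def IsHomLift (u : ℂ → P1) (p q : ℂ → ℂ) : Prop :=
  ContinuousOn p (Metric.closedBall 0 1) ∧ ContinuousOn q (Metric.closedBall 0 1) ∧
    ∀ z ∈ Metric.closedBall (0 : ℂ) 1, (p z ≠ 0 ∨ q z ≠ 0) ∧ u z = ofHom (p z) (q z)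

end P1

/-- The chart `ℂ × ℂ` of `ℙ¹ × ℙ¹`. -/
def affinePoint (x : ℂ × ℂ) : P1 × P1 := ((x.1 : P1), (x.2 : P1))

/-- The torus `T_{r,λ} = {|z₁² z₂ - ε| = r, |z₁|⁴ - |z₂|² = λ}`, in the chart `ℂ × ℂ` of the
deformed Hirzebruch surface `ℙ¹ × ℙ¹`. -/
def liftedChekanovTorus (ε : ℂ) (r lam : ℝ) : Set (ℂ × ℂ) :=
  {x | ‖x.1 ^ 2 * x.2 - ε‖ = r ∧ ‖x.1‖ ^ 4 - ‖x.2‖ ^ 2 = lam}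

/-- `u : (D², ∂D²) → (ℙ¹ × ℙ¹, L)` is a holomorphic disc: continuous on the closed unit disc,
holomorphic in its interior, with boundary on `L ⊆ ℂ × ℂ`. -/
def IsHolomorphicDisc (L : Set (ℂ × ℂ)) (u : ℂ → P1 × P1) : Prop :=
  P1.IsMeromorphicDisc (fun z => (u z).1) ∧ P1.IsMeromorphicDisc (fun z => (u z).2) ∧
    ∀ z ∈ Metric.sphere (0 : ℂ) 1, u z ∈ affinePoint '' L

/-- The disc `u` with boundary on the totally real surface `L ⊆ ℂ × ℂ ⊆ ℙ¹ × ℙ¹` has Maslov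
index `n`.

A lift `(p, q)` of a map to `ℙ¹` to homogeneous coordinates trivialises the pullback of
`Tℙ¹ = Hom(ℓ, ℂ²/ℓ)` over the disc by `ζ ↦ q dp(ζ) - p dq(ζ)`, which is `q² dz(ζ)` in the affine
coordinate `z = p / q`. In the resulting trivialisation of `u^* T(ℙ¹ × ℙ¹)` over the disc, a real
basis `v, w` of the tangent plane of `L` has complex determinant
`q₁² q₂² (v₁ w₂ - v₂ w₁)`, and the Maslov index is the degree of the normalised square of this
determinant along the boundary circle. The square, up to a positive factor, does not depend on
the basis. -/
def HasMaslovIndex (L : Set (ℂ × ℂ)) (u : ℂ → P1 × P1) (n : ℤ) : Prop :=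
  ∃ p₁ q₁ p₂ q₂ : ℂ → ℂ,
    P1.IsHomLift (fun z => (u z).1) p₁ q₁ ∧ P1.IsHomLift (fun z => (u z).2) p₂ q₂ ∧
    ∃ θ : ℝ → ℝ, Continuous θ ∧ θ (2 * Real.pi) - θ 0 = 2 * Real.pi * n ∧
      ∀ t : ℝ, ∃ x ∈ L, u (Complex.exp (t * Complex.I)) = affinePoint x ∧
        ∃ v ∈ tangentConeAt ℝ L x, ∃ w ∈ tangentConeAt ℝ L x, ∃ c : ℝ, 0 < c ∧
          (q₁ (Complex.exp (t * Complex.I)) ^ 2 * q₂ (Complex.exp (t * Complex.I)) ^ 2 *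
            (v.1 * w.2 - v.2 * w.1)) ^ 2 = c * Complex.exp (θ t * Complex.I)

/-- `u` is an index `0` disc bounded by `L`: a nonconstant holomorphic disc with boundary on `L`
whose Maslov index is `0`. -/
def IsIndexZeroDisc (L : Set (ℂ × ℂ)) (u : ℂ → P1 × P1) : Prop :=
  IsHolomorphicDisc L u ∧
    (∃ z ∈ Metric.closedBall (0 : ℂ) 1, ∃ z' ∈ Metric.closedBall (0 : ℂ) 1, u z ≠ u z') ∧
    HasMaslovIndex L u 0

/-- The walls in the base `{(r, λ) : 0 < r < |ε|}` of the family of tori `T_{r,λ}`: the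
parameters of those tori that bound an index `0` disc. -/
def walls (ε : ℂ) : Set (ℝ × ℝ) :=
  {b | 0 < b.1 ∧ b.1 < ‖ε‖ ∧ ∃ u, IsIndexZeroDisc (liftedChekanovTorus ε b.1 b.2) u}

end

/-! The core is a descent for finite Blaschke products (`eq_zero_of_two_even_fibres`). Suppose that
the zeros of F and its preimages of some c with 0 < |c| < 1 all have even multiplicity. Then F = h²
with h again unimodular on the circle. If a² = c, the factors of F - c = (h - a)(h + a) have no
common zeros, so h takes both values a and -a evenly. A disc automorphism sending a to 0 turns h
into a function k of the same kind with fewer double points. By induction k has no zeros, so it is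
constant of modulus one; but a zero of h gives it the value -a, of modulus less than one.

For a meromorphic u that avoids the interior of Δ, the descent applies to r / (u - ε). Its zeros are
the poles of u, and its fibre over -r/ε consists of the zeros of u.

For a disc on the torus, write z₁ = P₁/Q₁ and z₂ = P₂/Q₂, with sᵢ zeros and tᵢ poles, and let ρ
count the zeros of H = P₁²P₂ - εQ₁²Q₂. The tangent determinant is a real multiple of (z₁²z₂ - ε)/z₁,
so the Maslov index is 2(t₂ + ρ + t₁ - s₁). Along the boundary z₁²z₂ does not wind around 0, so 2(s₁
- t₁) + s₂ - t₂ = 0, and the index equals s₂ + t₂ + 2ρ. If it vanishes, z₂ has no zeros or poles and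
z₁²z₂ never takes the value ε, so the descent applies to r / (z₁²z₂ - ε). It excludes the poles and
hence the zeros of z₁, and the maximum principle makes the disc constant. -/

open Metric ComplexConjugate

/-! ### Polynomials given by multisets of roots -/

/-- The monic polynomial function with the given multiset of roots. -/
noncomputable def rootProd (S : Multiset ℂ) (z : ℂ) : ℂ := (S.map fun a => z - a).prod

@[simp] lemma rootProd_zero (z : ℂ) : rootProd 0 z = 1 := by simp [rootProd]

@[simp] lemma rootProd_cons (a : ℂ) (S : Multiset ℂ) (z : ℂ) :
    rootProd (a ::ₘ S) z = (z - a) * rootProd S z := by simp [rootProd]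

lemma rootProd_add (S T : Multiset ℂ) (z : ℂ) :
    rootProd (S + T) z = rootProd S z * rootProd T z := by simp [rootProd]

lemma rootProd_nsmul (n : ℕ) (S : Multiset ℂ) (z : ℂ) :
    rootProd (n • S) z = rootProd S z ^ n := by
  simp [rootProd, Multiset.map_nsmul, Multiset.prod_nsmul]

lemma rootProd_eq_zero_iff {S : Multiset ℂ} {z : ℂ} : rootProd S z = 0 ↔ z ∈ S := by
  simp [rootProd, Multiset.prod_eq_zero_iff, sub_eq_zero]

lemma differentiable_rootProd (S : Multiset ℂ) : Differentiable ℂ (rootProd S) := by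
  induction S using Multiset.induction_on with
  | empty =>
    have : rootProd 0 = fun _ => 1 := by ext; simp
    rw [this]; exact differentiable_const 1
  | cons a S ih =>
    have : rootProd (a ::ₘ S) = fun z => (z - a) * rootProd S z := by ext; simp
    rw [this]; fun_prop

lemma continuous_rootProd (S : Multiset ℂ) : Continuous (rootProd S) :=
  (differentiable_rootProd S).continuous

lemma analyticAt_rootProd (S : Multiset ℂ) (z : ℂ) : AnalyticAt ℂ (rootProd S) z :=
  (differentiable_rootProd S).analyticAt z

lemma analyticOrderAt_rootProd (S : Multiset ℂ) (z : ℂ) :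
    analyticOrderAt (rootProd S) z = S.count z := by
  induction S using Multiset.induction_on with
  | empty =>
    rw [(analyticAt_rootProd 0 z).analyticOrderAt_eq_zero.2] <;> simp
  | cons a S ih =>
    have h : rootProd (a ::ₘ S) = (fun x => x - a) * rootProd S := by
      ext x; simp
    have ha : AnalyticAt ℂ (fun x : ℂ => x - a) z := by fun_prop
    rw [h, analyticOrderAt_mul ha (analyticAt_rootProd S z), ih, Multiset.count_cons]
    split_ifs with hz
    · subst hz
      have : analyticOrderAt (fun x : ℂ => x - z) z = 1 := analyticOrderAt_id_sub_const_self
      rw [this]; push_cast; ring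
    · rw [ha.analyticOrderAt_eq_zero.2 (sub_ne_zero.2 hz)]; simp

lemma eventually_rootProd_ne_zero (T : Multiset ℂ) (z : ℂ) :
    ∀ᶠ x in 𝓝[≠] z, rootProd T x ≠ 0 := by
  rcases (analyticAt_rootProd T z).eventually_eq_zero_or_eventually_ne_zero with h | h
  · rw [← analyticOrderAt_eq_top, analyticOrderAt_rootProd] at h
    simp at h
  · exact h

lemma rootProd_ne_zero_of_mem_sphere {S : Multiset ℂ} (hS : ∀ a ∈ S, a ∈ ball (0 : ℂ) 1) {z : ℂ}
    (hz : z ∈ sphere (0 : ℂ) 1) : rootProd S z ≠ 0 := by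
  intro h
  have := hS z (rootProd_eq_zero_iff.1 h)
  simp_all

lemma mem_sphere_of_not_mem_ball {z : ℂ} (hz : z ∈ closedBall (0 : ℂ) 1)
    (h : z ∉ ball (0 : ℂ) 1) : z ∈ sphere (0 : ℂ) 1 := by
  rw [mem_sphere]; rw [mem_closedBall] at hz; rw [mem_ball, not_lt] at h; exact le_antisymm hz h

/-! ### The maximum principle on the disc -/

section Hol

variable {f g : ℂ → ℂ}

lemma DiffContOnCl.fun_mul (hf : DiffContOnCl ℂ f (ball 0 1)) (hg : DiffContOnCl ℂ g (ball 0 1)) :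
    DiffContOnCl ℂ (fun z => f z * g z) (ball 0 1) := hf.smul hg

lemma DiffContOnCl.fun_pow (hf : DiffContOnCl ℂ f (ball 0 1)) (n : ℕ) :
    DiffContOnCl ℂ (fun z => f z ^ n) (ball 0 1) :=
  ⟨hf.differentiableOn.pow n, hf.continuousOn.pow n⟩

lemma DiffContOnCl.fun_div (hf : DiffContOnCl ℂ f (ball 0 1)) (hg : DiffContOnCl ℂ g (ball 0 1))
    (h0 : ∀ z ∈ closedBall (0 : ℂ) 1, g z ≠ 0) :
    DiffContOnCl ℂ (fun z => f z / g z) (ball 0 1) := by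
  rw [← closure_ball (0 : ℂ) one_ne_zero] at h0
  simp only [div_eq_mul_inv]
  exact hf.fun_mul (hg.inv h0)

lemma diffContOnCl_rootProd (S : Multiset ℂ) : DiffContOnCl ℂ (rootProd S) (ball 0 1) :=
  (differentiable_rootProd S).diffContOnCl

lemma DiffContOnCl.analyticAt_of_mem (hf : DiffContOnCl ℂ f (ball 0 1)) {z : ℂ}
    (hz : z ∈ ball (0 : ℂ) 1) : AnalyticAt ℂ f z :=
  hf.differentiableOn.analyticAt (isOpen_ball.mem_nhds hz)

lemma DiffContOnCl.norm_le_of_sphere (hf : DiffContOnCl ℂ f (ball 0 1)) {C : ℝ}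
    (h : ∀ z ∈ sphere (0 : ℂ) 1, ‖f z‖ ≤ C) {z : ℂ} (hz : z ∈ closedBall (0 : ℂ) 1) :
    ‖f z‖ ≤ C := by
  refine Complex.norm_le_of_forall_mem_frontier_norm_le isBounded_ball hf ?_ ?_
  · rwa [frontier_ball _ one_ne_zero]
  · rwa [closure_ball _ one_ne_zero]

/-- A zero-free function of constant modulus on the unit circle is constant. -/
lemma DiffContOnCl.eq_of_norm_sphere (hf : DiffContOnCl ℂ f (ball 0 1))
    (h0 : ∀ z ∈ closedBall (0 : ℂ) 1, f z ≠ 0) {C : ℝ}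
    (h : ∀ z ∈ sphere (0 : ℂ) 1, ‖f z‖ = C) :
    ‖f 0‖ = C ∧ ∀ z ∈ closedBall (0 : ℂ) 1, f z = f 0 := by
  have hC : 0 < C := by
    have h1 : (1 : ℂ) ∈ sphere (0 : ℂ) 1 := by simp
    rw [← h 1 h1]; exact norm_pos_iff.2 (h0 1 (sphere_subset_closedBall h1))
  have hle : ∀ z ∈ closedBall (0 : ℂ) 1, ‖f z‖ ≤ C := fun z hz =>
    hf.norm_le_of_sphere (fun z hz => (h z hz).le) hz
  -- The maximum principle for 1/f gives the lower bound, so |f| is constant and has an interior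
  -- maximum at 0.
  have hinv : DiffContOnCl ℂ (fun z => 1 / f z) (ball 0 1) :=
    diffContOnCl_const.fun_div hf h0
  have hge : ∀ z ∈ closedBall (0 : ℂ) 1, C ≤ ‖f z‖ := fun z hz => by
    have := hinv.norm_le_of_sphere (C := 1 / C) (fun z hz => by rw [norm_div, h z hz]; simp) hz
    rw [norm_div, norm_one] at this
    exact (one_div_le_one_div (norm_pos_iff.2 (h0 z hz)) hC).1 this
  have hc0 : (0 : ℂ) ∈ closedBall (0 : ℂ) 1 := by simp
  refine ⟨le_antisymm (hle 0 hc0) (hge 0 hc0), fun z hz => ?_⟩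
  have := Complex.eqOn_closure_of_isPreconnected_of_isMaxOn_norm
    (convex_ball (0 : ℂ) 1).isPreconnected isOpen_ball hf (mem_ball_self one_pos)
    (fun z hz => by
      exact (hle z (ball_subset_closedBall hz)).trans (hge 0 hc0))
  rw [closure_ball _ one_ne_zero] at this
  exact this hz

end Hol

/-! ### Extraction of zeros and poles -/

/-- The multiset with the (nonnegative) multiplicities `d`. -/
noncomputable def multisetOf (s : Finset ℂ) (d : ℂ → ℕ) : Multiset ℂ := ∑ a ∈ s, d a • {a}

lemma rootProd_multisetOf (s : Finset ℂ) (d : ℂ → ℕ) (z : ℂ) :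
    rootProd (multisetOf s d) z = ∏ a ∈ s, (z - a) ^ d a := by
  unfold multisetOf
  induction s using Finset.induction_on with
  | empty => simp
  | insert a s ha ih =>
    rw [Finset.sum_insert ha, Finset.prod_insert ha, rootProd_add, ih, rootProd_nsmul]
    congr 2
    simp [rootProd]

lemma mem_multisetOf {s : Finset ℂ} {d : ℂ → ℕ} {z : ℂ} (h : z ∈ multisetOf s d) :
    z ∈ s ∧ d z ≠ 0 := by
  have := rootProd_eq_zero_iff.2 h
  rw [rootProd_multisetOf, Finset.prod_eq_zero_iff] at this
  obtain ⟨a, ha, h⟩ := this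
  have h3 : d a ≠ 0 := by rintro h0; simp [h0] at h
  have h4 : z = a := sub_eq_zero.1 ((pow_eq_zero_iff h3).1 h)
  subst h4; exact ⟨ha, h3⟩

/-- Extraction of the zeros and poles of a function on the unit disc that is meromorphic in the
interior and continuous and nonvanishing near the boundary. -/
theorem exists_eq_mul_rootProd_div {f : ℂ → ℂ} (hf : MeromorphicNFOn f (ball 0 1))
    {V : Set ℂ} (hV : IsCompact V) (hVb : V ⊆ ball 0 1)
    (hV0 : ∀ z ∈ closedBall (0 : ℂ) 1, z ∉ V → f z ≠ 0)
    (hcont : ∀ z ∈ sphere (0 : ℂ) 1, ContinuousWithinAt f (closedBall 0 1) z) :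
    ∃ (S T : Multiset ℂ) (G : ℂ → ℂ), (∀ a ∈ S, a ∈ ball (0 : ℂ) 1) ∧
      (∀ a ∈ T, a ∈ ball (0 : ℂ) 1) ∧ (∀ z, z ∈ S → z ∉ T) ∧
      DiffContOnCl ℂ G (ball 0 1) ∧ (∀ z ∈ closedBall (0 : ℂ) 1, G z ≠ 0) ∧
      (∀ z ∈ sphere (0 : ℂ) 1, f z = G z * rootProd S z / rootProd T z) ∧
      ∀ z ∈ ball (0 : ℂ) 1, ∀ᶠ x in 𝓝[≠] z, f x = G x * rootProd S x / rootProd T x := by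
  classical
  have hm : MeromorphicOn f (ball 0 1) := hf.meromorphicOn
  -- A meromorphic function in normal form has the value 0 at its poles too, so a nonzero value
  -- means order zero. Hence all zeros and poles lie in `V`.
  have hord : ∀ z ∈ ball (0 : ℂ) 1, z ∉ V → meromorphicOrderAt f z = 0 := fun z hz hzV =>
    (hf hz).meromorphicOrderAt_eq_zero_iff.2 (hV0 z (ball_subset_closedBall hz) hzV)
  -- One point of finite order excludes infinite order everywhere, since the disc is connected.
  obtain ⟨z₀, hz₀, hz₀V⟩ : ∃ z ∈ ball (0 : ℂ) 1, z ∉ V := by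
    by_contra! h
    have hVe : V = ball 0 1 := Subset.antisymm hVb h
    have h1 : IsClosed (ball (0 : ℂ) 1) := hVe ▸ hV.isClosed
    have h2 := h1.closure_eq
    rw [closure_ball _ one_ne_zero] at h2
    have h3 : (1 : ℂ) ∈ closedBall (0 : ℂ) 1 := by simp
    rw [h2] at h3; simp at h3
  have hntop : ∀ z : ball (0 : ℂ) 1, meromorphicOrderAt f z ≠ ⊤ := fun z =>
    hm.meromorphicOrderAt_ne_top_of_isPreconnected (x := z₀)
      (convex_ball (0 : ℂ) 1).isPreconnected hz₀ z.2 (by rw [hord z₀ hz₀ hz₀V]; simp)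
  set D := MeromorphicOn.divisor f (ball 0 1) with hD
  have hsupp : D.support ⊆ V := by
    intro z hz
    by_contra hzV
    have hzb : z ∈ ball (0 : ℂ) 1 := D.supportWithinDomain hz
    apply hz
    rw [hD, MeromorphicOn.divisor_apply hm hzb, hord z hzb hzV]; rfl
  have hfin : D.support.Finite := by
    have hsub : D.support ⊆ V ∩ D.support := fun z hz => ⟨hsupp hz, hz⟩
    refine Set.Finite.subset ?_ hsub
    refine hV.induction_on (p := fun s => (s ∩ D.support).Finite) (by simp)
      (fun s t hst ht => ht.subset (inter_subset_inter_left _ hst))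
      (fun s t hs ht => by rw [union_inter_distrib_right]; exact hs.union ht) fun z hz => ?_
    obtain ⟨t, ht, hft⟩ := D.supportLocallyFiniteWithinDomain z (hVb hz)
    exact ⟨t, mem_nhdsWithin_of_mem_nhds ht, hft⟩
  obtain ⟨g, hga, hg0, hfg⟩ := hm.extract_zeros_poles hntop hfin
  set S := multisetOf hfin.toFinset fun a => (D a).toNat
  set T := multisetOf hfin.toFinset fun a => (-D a).toNat
  have hmemV : ∀ a ∈ hfin.toFinset, a ∈ ball (0 : ℂ) 1 := fun a ha =>
    hVb (hsupp (hfin.mem_toFinset.1 ha))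
  have hSb : ∀ a ∈ S, a ∈ ball (0 : ℂ) 1 := fun a ha => hmemV a (mem_multisetOf ha).1
  have hTb : ∀ a ∈ T, a ∈ ball (0 : ℂ) 1 := fun a ha => hmemV a (mem_multisetOf ha).1
  have hφ : ∀ z, (∏ᶠ u, (· - u) ^ D u) z = rootProd S z / rootProd T z := by
    intro z
    rw [Function.FactorizedRational.finprod_eq_fun hfin]
    simp only []
    rw [finprod_eq_prod_of_mulSupport_subset (s := hfin.toFinset), rootProd_multisetOf,
      rootProd_multisetOf, ← Finset.prod_div_distrib]
    · refine Finset.prod_congr rfl fun a _ => ?_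
      rcases le_total 0 (D a) with h | h
      · rw [Int.toNat_of_nonpos (by omega : -D a ≤ 0), pow_zero, div_one, ← zpow_natCast,
          Int.toNat_of_nonneg h]
      · rw [Int.toNat_of_nonpos h, pow_zero, one_div, ← zpow_natCast,
          Int.toNat_of_nonneg (by omega : 0 ≤ -D a), zpow_neg, inv_inv]
    · intro u
      contrapose
      simp_all
  have hSV : ∀ a ∈ S, a ∈ V := fun a ha => hsupp (hfin.mem_toFinset.1 (mem_multisetOf ha).1)
  have hev : ∀ z ∈ ball (0 : ℂ) 1, ∀ᶠ x in 𝓝[≠] z,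
      f x = g x * rootProd S x / rootProd T x := by
    intro z hz
    rw [Filter.EventuallyEq, Filter.Eventually, mem_codiscreteWithin] at hfg
    have := hfg z hz
    rw [disjoint_principal_right] at this
    filter_upwards [this, mem_nhdsWithin_of_mem_nhds (isOpen_ball.mem_nhds hz)] with x hx hxb
    have : x ∈ {x | f x = ((∏ᶠ u, (· - u) ^ D u) • g) x} := by
      by_contra h; exact hx ⟨hxb, h⟩
    rw [mem_ofPred_eq, Pi.smul_apply', hφ, smul_eq_mul] at this
    rw [this]; ring
  have hTsphere : ∀ z ∈ sphere (0 : ℂ) 1, rootProd T z ≠ 0 := fun z hz =>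
    rootProd_ne_zero_of_mem_sphere hTb hz
  have hSsphere : ∀ z ∈ sphere (0 : ℂ) 1, rootProd S z ≠ 0 := fun z hz =>
    rootProd_ne_zero_of_mem_sphere hSb hz
  have hneV : ∀ z ∈ sphere (0 : ℂ) 1, z ∉ V := fun z hz h => by
    have := hVb h; simp_all
  -- The cofactor `g` lives on the open disc only. On the circle the factorization forces the value
  -- of `G`, and off `V` the same formula returns `g`. As `V` stays away from the circle, continuity
  -- of `f` there passes to `G`.
  set G : ℂ → ℂ := fun z => if z ∈ ball (0 : ℂ) 1 then g z else f z * rootProd T z / rootProd S z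
    with hG
  have hGb : ∀ z ∈ ball (0 : ℂ) 1, G z = g z := fun z hz => if_pos hz
  have hGs : ∀ z ∈ sphere (0 : ℂ) 1, G z = f z * rootProd T z / rootProd S z := fun z hz =>
    if_neg (by simp_all)
  have hnV : ∀ z ∈ closedBall (0 : ℂ) 1, z ∉ V → G z = f z * rootProd T z / rootProd S z := by
    intro z hz hzV
    by_cases hzb : z ∈ ball (0 : ℂ) 1
    · rw [hGb z hzb]
      have hz0 : D z = 0 := by
        by_contra h; exact hzV (hsupp h)
      have hS0 : rootProd S z ≠ 0 := fun h => (mem_multisetOf (rootProd_eq_zero_iff.1 h)).2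
        (by simp [hz0])
      have hT0 : rootProd T z ≠ 0 := fun h => (mem_multisetOf (rootProd_eq_zero_iff.1 h)).2
        (by simp [hz0])
      have ha : AnalyticAt ℂ (fun x => g x * rootProd S x / rootProd T x) z :=
        ((hga z hzb).mul (analyticAt_rootProd S z)).div (analyticAt_rootProd T z) hT0
      have := ((hf hzb).eventuallyEq_nhdsNE_iff_eventuallyEq_nhds ha.meromorphicNFAt).1 (hev z hzb)
      rw [this.self_of_nhds]
      field_simp
    · exact hGs z (mem_sphere_of_not_mem_ball hz hzb)
  refine ⟨S, T, G, hSb, hTb, ?_, ⟨?_, ?_⟩, ?_, ?_, ?_⟩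
  · intro z hz hz'
    have h1 := (mem_multisetOf hz).2
    have h2 := (mem_multisetOf hz').2
    omega
  · exact DifferentiableOn.congr (f := g) (fun z hz => (hga z hz).differentiableWithinAt) hGb
  · rw [closure_ball _ one_ne_zero]
    intro z hz
    by_cases hzb : z ∈ ball (0 : ℂ) 1
    · refine ((hga z hzb).continuousAt.congr ?_).continuousWithinAt
      filter_upwards [isOpen_ball.mem_nhds hzb] with x hx using (hGb x hx).symm
    · have hzs := mem_sphere_of_not_mem_ball hz hzb
      have h1 : ContinuousWithinAt (fun z => f z * rootProd T z / rootProd S z)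
          (closedBall 0 1) z :=
        ((hcont z hzs).mul (continuous_rootProd T).continuousWithinAt).div
          (continuous_rootProd S).continuousWithinAt (hSsphere z hzs)
      refine h1.congr_of_eventuallyEq ?_ (hGs z hzs)
      filter_upwards [self_mem_nhdsWithin, mem_nhdsWithin_of_mem_nhds
        (hV.isClosed.isOpen_compl.mem_nhds (hneV z hzs))] with x hx hxV using hnV x hx hxV
  · intro z hz
    by_cases hzb : z ∈ ball (0 : ℂ) 1
    · rw [hGb z hzb]; exact hg0 ⟨z, hzb⟩
    · have hzs := mem_sphere_of_not_mem_ball hz hzb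
      rw [hGs z hzs]
      exact div_ne_zero (mul_ne_zero (hV0 z hz (hneV z hzs)) (hTsphere z hzs)) (hSsphere z hzs)
  · intro z hz
    rw [hGs z hz]
    have := hTsphere z hz
    have := hSsphere z hz
    field_simp
  · intro z hz
    filter_upwards [hev z hz, mem_nhdsWithin_of_mem_nhds (isOpen_ball.mem_nhds hz)] with x hx hxb
    rw [hx, hGb x hxb]

/-- Extraction of the zeros of a holomorphic function on the disc without zeros on the circle. -/
theorem DiffContOnCl.exists_eq_mul_rootProd {f : ℂ → ℂ} (hf : DiffContOnCl ℂ f (ball 0 1))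
    (h0 : ∀ z ∈ sphere (0 : ℂ) 1, f z ≠ 0) :
    ∃ (S : Multiset ℂ) (G : ℂ → ℂ), (∀ a ∈ S, a ∈ ball (0 : ℂ) 1) ∧
      DiffContOnCl ℂ G (ball 0 1) ∧ (∀ z ∈ closedBall (0 : ℂ) 1, G z ≠ 0) ∧
      ∀ z ∈ closedBall (0 : ℂ) 1, f z = G z * rootProd S z := by
  have hc : ContinuousOn f (closedBall 0 1) := hf.continuousOn_ball
  obtain ⟨S, T, G, hS, hT, hST, hG, hG0, hs, hb⟩ :=
    exists_eq_mul_rootProd_div (f := f) (V := closedBall 0 1 ∩ f ⁻¹' {0})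
      (fun z hz => (hf.analyticAt_of_mem hz).meromorphicNFAt)
      ((isCompact_closedBall (0 : ℂ) 1).of_isClosed_subset
        (hc.preimage_isClosed_of_isClosed isClosed_closedBall isClosed_singleton)
        inter_subset_left)
      (fun z hz => by
        by_contra h
        exact h0 z (mem_sphere_of_not_mem_ball hz.1 h) hz.2)
      (fun z hz h hz0 => h ⟨hz, hz0⟩)
      (fun z hz => hc z (sphere_subset_closedBall hz))
  have hmul : ∀ z ∈ ball (0 : ℂ) 1, f z * rootProd T z = G z * rootProd S z := by
    intro z hz
    have h1 : ContinuousAt (fun x => f x * rootProd T x) z :=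
      (hf.analyticAt_of_mem hz).continuousAt.mul (continuous_rootProd T).continuousAt
    have h2 : ContinuousAt (fun x => G x * rootProd S x) z :=
      (hG.analyticAt_of_mem hz).continuousAt.mul (continuous_rootProd S).continuousAt
    refine tendsto_nhds_unique (h1.mono_left nhdsWithin_le_nhds)
      ((h2.mono_left nhdsWithin_le_nhds).congr' (f₁ := _) (l₁ := 𝓝[≠] z) ?_)
    filter_upwards [hb z hz, eventually_rootProd_ne_zero T z] with x hx hT
    rw [hx]; field_simp
  -- A root of `T` would be a zero of `G * rootProd S`, but `G` is zero-free and `S`, `T` are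
  -- disjoint.
  have hT0 : T = 0 := by
    rw [Multiset.eq_zero_iff_forall_notMem]
    intro b hbT
    have h := hmul b (hT b hbT)
    rw [rootProd_eq_zero_iff.2 hbT, mul_zero] at h
    rcases mul_eq_zero.1 h.symm with h | h
    · exact hG0 b (ball_subset_closedBall (hT b hbT)) h
    · exact hST b (rootProd_eq_zero_iff.1 h) hbT
  refine ⟨S, G, hS, hG, hG0, fun z hz => ?_⟩
  by_cases hzb : z ∈ ball (0 : ℂ) 1
  · simpa [hT0] using hmul z hzb
  · simpa [hT0] using hs z (mem_sphere_of_not_mem_ball hz hzb)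

/-! ### Blaschke products and the descent on even fibres -/

lemma one_sub_conj_mul_ne_zero {a w : ℂ} (ha : ‖a‖ < 1) (hw : ‖w‖ ≤ 1) : 1 - conj a * w ≠ 0 := by
  intro h
  have h1 : ‖conj a * w‖ = 1 := by rw [← sub_eq_zero.1 h, norm_one]
  rw [norm_mul, RCLike.norm_conj] at h1
  nlinarith [norm_nonneg a, norm_nonneg w]

/-- On the unit circle w⁻¹ is the conjugate of w, so w - a is w times the conjugate of the other
expression. This makes Blaschke factors unimodular there. -/
lemma norm_sub_eq_norm_one_sub_conj_mul {a w : ℂ} (hw : ‖w‖ = 1) :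
    ‖w - a‖ = ‖1 - conj a * w‖ := by
  have h1 : w * conj w = 1 := by rw [Complex.mul_conj']; simp [hw]
  have : w - a = w * conj (1 - conj a * w) := by
    simp only [map_sub, map_mul, map_one, Complex.conj_conj]
    linear_combination a * h1
  rw [this, norm_mul, hw, one_mul, RCLike.norm_conj]

/-- The denominator of the Blaschke product with zeros `S`. -/
noncomputable def blaschkeDenom (S : Multiset ℂ) (z : ℂ) : ℂ :=
  (S.map fun a => 1 - conj a * z).prod

lemma differentiable_blaschkeDenom (S : Multiset ℂ) : Differentiable ℂ (blaschkeDenom S) := by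
  induction S using Multiset.induction_on with
  | empty =>
    have : blaschkeDenom 0 = fun _ => 1 := by ext; simp [blaschkeDenom]
    rw [this]; exact differentiable_const 1
  | cons a S ih =>
    have : blaschkeDenom (a ::ₘ S) = fun z => (1 - conj a * z) * blaschkeDenom S z := by
      ext; simp [blaschkeDenom]
    rw [this]; fun_prop

lemma blaschkeDenom_ne_zero {S : Multiset ℂ} (hS : ∀ a ∈ S, a ∈ ball (0 : ℂ) 1) {z : ℂ}
    (hz : z ∈ closedBall (0 : ℂ) 1) : blaschkeDenom S z ≠ 0 := by
  simp only [blaschkeDenom, ne_eq, Multiset.prod_eq_zero_iff, Multiset.mem_map, not_exists, not_and]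
  intro a ha
  exact one_sub_conj_mul_ne_zero (by simpa using hS a ha) (by simpa using hz)

lemma norm_rootProd_eq_norm_blaschkeDenom (S : Multiset ℂ) {z : ℂ} (hz : z ∈ sphere (0 : ℂ) 1) :
    ‖rootProd S z‖ = ‖blaschkeDenom S z‖ := by
  induction S using Multiset.induction_on with
  | empty => simp [blaschkeDenom]
  | cons a S ih =>
    rw [rootProd_cons, norm_mul, ih, norm_sub_eq_norm_one_sub_conj_mul (by simpa using hz),
      ← norm_mul]
    simp [blaschkeDenom]

lemma analyticOrderAt_mul_of_ne_zero {f u : ℂ → ℂ} {z : ℂ} (hf : AnalyticAt ℂ f z)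
    (hu : AnalyticAt ℂ u z) (h0 : u z ≠ 0) :
    analyticOrderAt (fun x => f x * u x) z = analyticOrderAt f z := by
  have : analyticOrderAt (f * u) z = _ := analyticOrderAt_mul hf hu
  rw [hu.analyticOrderAt_eq_zero.2 h0, add_zero] at this
  exact this

/-- A finite Blaschke product all of whose zeros have even order is a square. -/
lemma DiffContOnCl.exists_sq_of_even_order {F : ℂ → ℂ} (hF : DiffContOnCl ℂ F (ball 0 1))
    (h1 : ∀ z ∈ sphere (0 : ℂ) 1, ‖F z‖ = 1) {T : Multiset ℂ}
    (hT : ∀ a ∈ T, a ∈ ball (0 : ℂ) 1)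
    (hord : ∀ z ∈ ball (0 : ℂ) 1, analyticOrderAt F z = ((2 * T.count z : ℕ) : ℕ∞)) :
    ∃ h : ℂ → ℂ, DiffContOnCl ℂ h (ball 0 1) ∧ ∀ z ∈ closedBall (0 : ℂ) 1, F z = h z ^ 2 := by
  classical
  obtain ⟨S, G, hS, hG, hG0, hFG⟩ := hF.exists_eq_mul_rootProd
    (fun z hz h => by have := h1 z hz; simp [h] at this)
  have hST : S = 2 • T := by
    ext z
    by_cases hz : z ∈ ball (0 : ℂ) 1
    · have h2 : analyticOrderAt F z = S.count z := by
        rw [← analyticOrderAt_rootProd, ← analyticOrderAt_mul_of_ne_zero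
          (analyticAt_rootProd S z) (hG.analyticAt_of_mem hz) (hG0 z (ball_subset_closedBall hz))]
        refine analyticOrderAt_congr ?_
        filter_upwards [isOpen_ball.mem_nhds hz] with x hx
        rw [hFG x (ball_subset_closedBall hx), mul_comm]
      rw [hord z hz] at h2
      rw [Multiset.count_nsmul]
      exact_mod_cast h2.symm
    · rw [Multiset.count_eq_zero_of_notMem (fun h => hz (hS z h)), Multiset.count_nsmul,
        Multiset.count_eq_zero_of_notMem (fun h => hz (hT z h))]
  have hFG' : ∀ z ∈ closedBall (0 : ℂ) 1, F z = G z * rootProd T z ^ 2 := fun z hz => by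
    rw [hFG z hz, hST, rootProd_nsmul]
  have hB : DiffContOnCl ℂ (blaschkeDenom T) (ball 0 1) :=
    (differentiable_blaschkeDenom T).diffContOnCl
  -- With B = `blaschkeDenom T`, the function G·B² is zero-free and has modulus |F| = 1 on the
  -- circle, hence is constant. So F is a constant times the square of `rootProd T` / B.
  obtain ⟨-, hK⟩ := (hG.fun_mul (hB.fun_pow 2)).eq_of_norm_sphere (C := 1)
    (fun z hz => mul_ne_zero (hG0 z hz) (pow_ne_zero 2 (blaschkeDenom_ne_zero hT hz)))
    (fun z hz => by
      rw [norm_mul, norm_pow, ← norm_rootProd_eq_norm_blaschkeDenom T hz, ← norm_pow, ← norm_mul,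
        ← hFG' z (sphere_subset_closedBall hz), h1 z hz])
  obtain ⟨s, hs⟩ := IsAlgClosed.exists_pow_nat_eq (G 0 * blaschkeDenom T 0 ^ 2) two_pos
  refine ⟨fun z => s * (rootProd T z / blaschkeDenom T z),
    diffContOnCl_const.fun_mul ((diffContOnCl_rootProd T).fun_div hB
      fun z hz => blaschkeDenom_ne_zero hT hz), fun z hz => ?_⟩
  have := blaschkeDenom_ne_zero hT hz
  rw [hFG' z hz, mul_pow, hs, ← hK z hz]
  field_simp

/-- A finite Blaschke product with zeros of even order only, and which takes a second value
`c ≠ 0` of the open disc with even multiplicities only, has no zeros. -/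
theorem eq_zero_of_two_even_fibres {F : ℂ → ℂ} (hF : DiffContOnCl ℂ F (ball 0 1))
    (h1 : ∀ z ∈ sphere (0 : ℂ) 1, ‖F z‖ = 1) {c : ℂ} (hc0 : c ≠ 0) (hc1 : ‖c‖ < 1)
    {T S : Multiset ℂ} (hT : ∀ a ∈ T, a ∈ ball (0 : ℂ) 1) (hS : ∀ a ∈ S, a ∈ ball (0 : ℂ) 1)
    (hordT : ∀ z ∈ ball (0 : ℂ) 1, analyticOrderAt F z = ((2 * T.count z : ℕ) : ℕ∞))
    (hordS : ∀ z ∈ ball (0 : ℂ) 1,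
      analyticOrderAt (fun x => F x - c) z = ((2 * S.count z : ℕ) : ℕ∞)) : T = 0 := by
  classical
  induction hn : Multiset.card T + Multiset.card S using Nat.strong_induction_on
    generalizing F c T S with
  | _ n ih =>
  by_contra hT0
  obtain ⟨b, hbT⟩ := Multiset.exists_mem_of_ne_zero hT0
  obtain ⟨h, hh, hFh⟩ := hF.exists_sq_of_even_order h1 hT hordT
  obtain ⟨a, rfl⟩ := IsAlgClosed.exists_pow_nat_eq c two_pos
  have ha0 : a ≠ 0 := by rintro rfl; simp at hc0
  have ha1 : ‖a‖ < 1 := by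
    rw [norm_pow] at hc1
    nlinarith [norm_nonneg a]
  have hh1 : ∀ z ∈ sphere (0 : ℂ) 1, ‖h z‖ = 1 := fun z hz => by
    have := h1 z hz
    rw [hFh z (sphere_subset_closedBall hz), norm_pow] at this
    nlinarith [norm_nonneg (h z)]
  have hhle : ∀ z ∈ closedBall (0 : ℂ) 1, ‖h z‖ ≤ 1 := fun z hz =>
    hh.norm_le_of_sphere (fun z hz => (hh1 z hz).le) hz
  set d : ℂ → ℂ := fun z => 1 - conj a * h z with hd
  have hd0 : ∀ z ∈ closedBall (0 : ℂ) 1, d z ≠ 0 := fun z hz =>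
    one_sub_conj_mul_ne_zero ha1 (hhle z hz)
  have hdD : DiffContOnCl ℂ d (ball 0 1) := (diffContOnCl_const.fun_mul hh).const_sub 1
  -- The disc automorphism w ↦ (w - a)/(1 - ā w) applied to h. It sends a to 0 and -a to `c'`, so
  -- the fibres of h over ±a become those of `k` over 0 and `c'`.
  set k : ℂ → ℂ := fun z => (h z - a) / d z with hk
  have hkD : DiffContOnCl ℂ k (ball 0 1) := (hh.sub_const a).fun_div hdD hd0
  have hk1 : ∀ z ∈ sphere (0 : ℂ) 1, ‖k z‖ = 1 := fun z hz => by
    rw [hk, norm_div, norm_sub_eq_norm_one_sub_conj_mul (hh1 z hz)]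
    exact div_self (norm_ne_zero_iff.2 (hd0 z (sphere_subset_closedBall hz)))
  have hN : conj a * a = ((‖a‖ ^ 2 : ℝ) : ℂ) := by
    rw [mul_comm, Complex.mul_conj']; push_cast; rfl
  have hNp : (1 + conj a * a) ≠ 0 := by
    rw [hN]; norm_cast; positivity
  have hNm : (1 - conj a * a) ≠ 0 := one_sub_conj_mul_ne_zero ha1 ha1.le
  set c' : ℂ := -2 * a / (1 + conj a * a) with hc'
  have hc'0 : c' ≠ 0 := div_ne_zero (mul_ne_zero (by norm_num) ha0) hNp
  have hc'1 : ‖c'‖ < 1 := by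
    have h2 : ‖1 + conj a * a‖ = 1 + ‖a‖ ^ 2 := by
      rw [hN, ← Complex.ofReal_one, ← Complex.ofReal_add, Complex.norm_real, Real.norm_eq_abs,
        abs_of_nonneg (by positivity)]
    rw [hc', norm_div, h2, norm_mul, div_lt_one (by positivity)]
    simp only [norm_neg, Complex.norm_ofNat]
    -- The claim 2|a| < 1 + |a|² is (1 - |a|)² > 0.
    nlinarith [sq_pos_of_pos (sub_pos.2 ha1)]
  have hkc : ∀ z ∈ closedBall (0 : ℂ) 1,
      k z - c' = (h z + a) * ((1 - conj a * a) / ((1 + conj a * a) * d z)) := fun z hz => by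
    have hdz := hd0 z hz
    simp only [hk, hc']
    rw [div_sub_div _ _ hdz hNp, ← mul_div_assoc, mul_comm (1 + conj a * a) (d z)]
    congr 1
    simp only [hd]; ring
  set I := S.filter fun s => h s = a with hI
  set J := S.filter fun s => ¬ h s = a with hJ
  have hcard : Multiset.card I + Multiset.card J = Multiset.card S := by
    rw [← Multiset.card_add, Multiset.filter_add_not]
  have hm : ∀ z ∈ ball (0 : ℂ) 1, AnalyticAt ℂ (fun x => h x - a) z := fun z hz =>
    (hh.analyticAt_of_mem hz).sub analyticAt_const
  have hp : ∀ z ∈ ball (0 : ℂ) 1, AnalyticAt ℂ (fun x => h x + a) z := fun z hz =>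
    (hh.analyticAt_of_mem hz).add analyticAt_const
  -- Since a ≠ 0, at most one of h - a and h + a vanishes at a point, and that one carries the whole
  -- even order of F - c.
  have hsplit : ∀ z ∈ ball (0 : ℂ) 1, analyticOrderAt (fun x => h x - a) z =
      ((2 * I.count z : ℕ) : ℕ∞) ∧
      analyticOrderAt (fun x => h x + a) z = ((2 * J.count z : ℕ) : ℕ∞) := by
    intro z hz
    have hsum : ((2 * S.count z : ℕ) : ℕ∞) =
        analyticOrderAt (fun x => h x - a) z + analyticOrderAt (fun x => h x + a) z := by
      rw [← analyticOrderAt_mul (hm z hz) (hp z hz), ← hordS z hz]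
      refine analyticOrderAt_congr ?_
      filter_upwards [isOpen_ball.mem_nhds hz] with x hx
      rw [hFh x (ball_subset_closedBall hx), Pi.mul_apply]; ring
    rw [hI, hJ, Multiset.count_filter, Multiset.count_filter]
    by_cases hza : h z = a
    · have h0 : analyticOrderAt (fun x => h x + a) z = 0 :=
        (hp z hz).analyticOrderAt_eq_zero.2 (by
          rw [hza, ← two_mul]; exact mul_ne_zero two_ne_zero ha0)
      rw [h0, add_zero] at hsum
      simp [hza, h0, ← hsum]
    · have h0 : analyticOrderAt (fun x => h x - a) z = 0 :=
        (hm z hz).analyticOrderAt_eq_zero.2 (sub_ne_zero.2 hza)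
      rw [h0, zero_add] at hsum
      simp [hza, h0, ← hsum]
  have hTpos : 0 < Multiset.card T := Multiset.card_pos.2 hT0
  -- The descent decreases because |I| + |J| = |S| and T is nonempty.
  have hI0 : I = 0 := by
    refine ih (Multiset.card I + Multiset.card J) (by omega) hkD hk1 hc'0 hc'1
      (fun s hs => hS s (Multiset.mem_of_mem_filter hs))
      (fun s hs => hS s (Multiset.mem_of_mem_filter hs)) (fun z hz => ?_) (fun z hz => ?_) rfl
    · rw [← (hsplit z hz).1]
      have hzc := ball_subset_closedBall hz
      rw [← analyticOrderAt_mul_of_ne_zero (hm z hz)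
        ((hdD.analyticAt_of_mem hz).inv (hd0 z hzc)) (inv_ne_zero (hd0 z hzc))]
      rfl
    · rw [← (hsplit z hz).2]
      have hzc := ball_subset_closedBall hz
      have hu0 : (1 + conj a * a) * d z ≠ 0 := mul_ne_zero hNp (hd0 z hzc)
      rw [← analyticOrderAt_mul_of_ne_zero (hp z hz)
        (u := fun x => (1 - conj a * a) / ((1 + conj a * a) * d x))
        (analyticAt_const.div (analyticAt_const.mul (hdD.analyticAt_of_mem hz)) hu0)
        (div_ne_zero hNm hu0)]
      refine analyticOrderAt_congr ?_
      filter_upwards [isOpen_ball.mem_nhds hz] with x hx using hkc x (ball_subset_closedBall hx)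
  have hk0 : ∀ z ∈ closedBall (0 : ℂ) 1, k z ≠ 0 := by
    intro z hz
    by_cases hzb : z ∈ ball (0 : ℂ) 1
    · have h2 := (hsplit z hzb).1
      rw [hI0] at h2
      have h3 : h z - a ≠ 0 := (hm z hzb).analyticOrderAt_eq_zero.1 (by simpa using h2)
      exact div_ne_zero h3 (hd0 z hz)
    · intro h0
      have := hk1 z (mem_sphere_of_not_mem_ball hz hzb)
      simp [h0] at this
  have hconst := (hkD.eq_of_norm_sphere hk0 hk1).2
  have hb := ball_subset_closedBall (hT b hbT)
  have h1c : (1 : ℂ) ∈ sphere (0 : ℂ) 1 := by simp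
  have hhb : h b = 0 := by
    have h2 := hordT b (hT b hbT)
    have h3 : F b = 0 := apply_eq_zero_of_analyticOrderAt_ne_zero (𝕜 := ℂ) (by
      rw [h2]
      have := Multiset.one_le_count_iff_mem.2 hbT
      have h4 : 2 * T.count b ≠ 0 := by omega
      exact_mod_cast h4)
    rw [hFh b hb] at h3
    simpa using h3
  have hkb : k b = -a := by simp [hk, hd, hhb]
  have := hk1 1 h1c
  rw [hconst 1 (sphere_subset_closedBall h1c), ← hconst b hb, hkb, norm_neg] at this
  exact ha1.ne this

/-! ### Charts of the projective line and the case of double zeros and poles -/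

namespace P1

@[simp] lemma coordZero_coe (z : ℂ) : coordZero (z : P1) = z := rfl
@[simp] lemma coordZero_infty : coordZero OnePoint.infty = 0 := rfl
@[simp] lemma coordInfty_coe (z : ℂ) : coordInfty (z : P1) = z⁻¹ := rfl
@[simp] lemma coordInfty_infty : coordInfty OnePoint.infty = 0 := rfl

@[simp] lemma ofHom_one_right (p : ℂ) : ofHom p 1 = (p : P1) := by simp [ofHom]

lemma ofHom_of_ne {p q : ℂ} (h : q ≠ 0) : ofHom p q = ((p / q : ℂ) : P1) := if_neg h

@[simp] lemma ofHom_zero_right (p : ℂ) : ofHom p 0 = OnePoint.infty := if_pos rfl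

lemma ofHom_ne_zero {p q : ℂ} (hp : p ≠ 0) : ofHom p q ≠ ((0 : ℂ) : P1) := by
  by_cases h : q = 0
  · simp [h]
  · rw [ofHom_of_ne h]
    simp [hp, h]

@[simp] lemma coordZero_ofHom (p q : ℂ) : coordZero (ofHom p q) = p / q := by
  by_cases h : q = 0
  · simp [h]
  · simp [ofHom_of_ne h]

@[simp] lemma coordInfty_ofHom (p q : ℂ) : coordInfty (ofHom p q) = q / p := by
  by_cases h : q = 0
  · simp [h]
  · simp [ofHom_of_ne h]

/-- The coordinate `r / (z - ε)`, centred at `∞` and meaningful away from `ε`. -/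
noncomputable def coordRecip (ε : ℂ) (r : ℝ) : P1 → ℂ
  | OnePoint.infty => 0
  | OnePoint.some z => r / (z - ε)

@[simp] lemma coordRecip_coe (ε : ℂ) (r : ℝ) (z : ℂ) : coordRecip ε r (z : P1) = r / (z - ε) := rfl
@[simp] lemma coordRecip_infty (ε : ℂ) (r : ℝ) : coordRecip ε r OnePoint.infty = 0 := rfl

lemma coordRecip_ofHom_one (ε : ℂ) (r : ℝ) (q : ℂ) :
    coordRecip ε r (ofHom 1 q) = q * (r / (1 - ε * q)) := by
  by_cases h : q = 0
  · simp [h]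
  · rw [ofHom_of_ne h, coordRecip_coe, show 1 / q - ε = (1 - ε * q) / q by field_simp,
      div_div_eq_mul_div]
    ring

lemma continuousAt_coordRecip {ε : ℂ} {r : ℝ} {p : P1} (hp : p ≠ (ε : P1)) :
    ContinuousAt (coordRecip ε r) p := by
  induction p using OnePoint.rec with
  | infty =>
    rw [OnePoint.continuousAt_infty', coclosedCompact_eq_cocompact]
    have h1 : Tendsto (fun z : ℂ => z - ε) (cocompact ℂ) (cocompact ℂ) :=
      (Homeomorph.subRight ε).isClosedEmbedding.tendsto_cocompact
    rw [← cobounded_eq_cocompact] at h1 ⊢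
    simpa [Function.comp_def, div_eq_mul_inv] using
      (tendsto_inv₀_cobounded.comp h1).const_mul (r : ℂ)
  | coe z =>
    rw [OnePoint.continuousAt_coe]
    have hz : z - ε ≠ 0 := sub_ne_zero.2 fun h => hp (by rw [h])
    have : (coordRecip ε r ∘ ((↑) : ℂ → P1)) = fun z => r / (z - ε) := rfl
    rw [this]
    fun_prop (disch := assumption)

/-- The identity r/(u - ε) + r/ε = r u/(ε (u - ε)) shows that the fibre over -r/ε records the zeros
of u, as the zeros of r/(u - ε) record its poles. Each chart gives the remaining factor as a local
unit. -/
lemma order_coordRecip {ε : ℂ} {r : ℝ} (hε : ε ≠ 0) (hr : r ≠ 0) {u : ℂ → P1} {a : ℂ}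
    (hu : HolomorphicAt u a) (ha : u a ≠ (ε : P1)) :
    AnalyticAt ℂ (fun z => coordRecip ε r (u z)) a ∧
      analyticOrderAt (fun z => coordRecip ε r (u z)) a = poleOrder u a ∧
      analyticOrderAt (fun z => coordRecip ε r (u z) - (-r / ε)) a = zeroOrder u a := by
  have hr' : (r : ℂ) ≠ 0 := by exact_mod_cast hr
  rcases hu with ⟨g, hg, hug⟩ | ⟨g, hg, hug⟩
  · have hga : g a - ε ≠ 0 := by
      rw [hug.self_of_nhds, ofHom_one_right] at ha
      exact sub_ne_zero.2 fun h => ha (by rw [h])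
    have han : AnalyticAt ℂ (fun z => r / (g z - ε)) a :=
      analyticAt_const.div (hg.sub analyticAt_const) hga
    have hev : (fun z => coordRecip ε r (u z)) =ᶠ[𝓝 a] fun z => r / (g z - ε) := by
      filter_upwards [hug] with z hz
      rw [hz, ofHom_one_right, coordRecip_coe]
    refine ⟨han.congr hev.symm, ?_, ?_⟩
    · rw [analyticOrderAt_congr hev, han.analyticOrderAt_eq_zero.2 (div_ne_zero hr' hga),
        poleOrder, if_neg (by rw [hug.self_of_nhds, ofHom_one_right]; simp)]
    · have h1 : analyticOrderAt (fun z => coordRecip ε r (u z) - (-r / ε)) a =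
          analyticOrderAt g a := by
        rw [← analyticOrderAt_mul_of_ne_zero hg (u := fun z => r / (ε * (g z - ε)))
          (analyticAt_const.div (analyticAt_const.mul (hg.sub analyticAt_const))
            (mul_ne_zero hε hga)) (div_ne_zero hr' (mul_ne_zero hε hga))]
        refine analyticOrderAt_congr ?_
        filter_upwards [hev, hg.continuousAt.sub_const ε |>.eventually_ne hga] with z hz hz0
        rw [hz]
        field_simp
        ring
      rw [h1, zeroOrder]
      split_ifs with h0
      · refine analyticOrderAt_congr ?_
        filter_upwards [hug] with z hz
        rw [hz]; simp
      · refine hg.analyticOrderAt_eq_zero.2 fun h => h0 ?_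
        rw [hug.self_of_nhds, h, ofHom_one_right]
  · have hga : 1 - ε * g a ≠ 0 := by
      intro h
      have h1 : ε * g a = 1 := (sub_eq_zero.1 h).symm
      have h2 : g a ≠ 0 := by rintro h2; simp [h2] at h1
      rw [hug.self_of_nhds, ofHom_of_ne h2] at ha
      exact ha (by rw [← h1]; field_simp)
    have hden : AnalyticAt ℂ (fun z => 1 - ε * g z) a :=
      analyticAt_const.sub (analyticAt_const.mul hg)
    have han : AnalyticAt ℂ (fun z => g z * (r / (1 - ε * g z))) a :=
      hg.mul (analyticAt_const.div hden hga)
    have hev : (fun z => coordRecip ε r (u z)) =ᶠ[𝓝 a] fun z => g z * (r / (1 - ε * g z)) := by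
      filter_upwards [hug] with z hz
      rw [hz, coordRecip_ofHom_one]
    refine ⟨han.congr hev.symm, ?_, ?_⟩
    · rw [analyticOrderAt_congr hev, analyticOrderAt_mul_of_ne_zero hg
        (u := fun z => r / (1 - ε * g z)) (analyticAt_const.div hden hga) (div_ne_zero hr' hga),
        poleOrder]
      split_ifs with h0
      · refine analyticOrderAt_congr ?_
        filter_upwards [hug] with z hz
        rw [hz]; simp
      · refine hg.analyticOrderAt_eq_zero.2 fun h => h0 ?_
        rw [hug.self_of_nhds, h, ofHom_zero_right]
    · rw [zeroOrder, if_neg (by rw [hug.self_of_nhds]; exact ofHom_ne_zero one_ne_zero)]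
      have h1 : (fun z => coordRecip ε r (u z) - (-r / ε)) =ᶠ[𝓝 a]
          fun z => r / (ε * (1 - ε * g z)) := by
        filter_upwards [hev, hden.continuousAt.eventually_ne hga] with z hz hz0
        rw [hz, ← mul_div_assoc, div_sub_div _ _ hz0 hε, mul_comm ε (1 - _)]
        congr 1
        ring
      rw [analyticOrderAt_congr h1]
      exact (analyticAt_const.div (analyticAt_const.mul hden)
        (mul_ne_zero hε hga)).analyticOrderAt_eq_zero.2 (div_ne_zero hr' (mul_ne_zero hε hga))

lemma count_map_univ {m : ℕ} (b : Fin m → ℂ) (z : ℂ) :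
    (Finset.univ.val.map b).count z = Nat.card {i : Fin m // b i = z} := by
  classical
  rw [Multiset.count_map, Nat.card_eq_fintype_card, Fintype.card_subtype]
  simp only [eq_comm (a := z)]
  rfl

theorem not_exists_double_zeros_double_poles {ε : ℂ} {r : ℝ} {m : ℕ} (hr : 0 < r) (hrε : r < ‖ε‖)
    (hm : 1 ≤ m) : ¬ ∃ ubar : ℂ → P1, IsMeromorphicDisc ubar ∧ MapsToComplementOfDisc ε r ubar ∧
      HasExactlyDoubleZeros ubar m ∧ HasExactlyDoublePoles ubar m := by
  rintro ⟨u, ⟨hc, hh⟩, ⟨hin, hbd⟩, ⟨a, ha, hz⟩, ⟨b, hb, hp⟩⟩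
  have hε : ε ≠ 0 := norm_pos_iff.1 (hr.trans hrε)
  have hne : ∀ z ∈ closedBall (0 : ℂ) 1, u z ≠ (ε : P1) := fun z hz h =>
    hin z hz ⟨ε, mem_ball_self hr, h.symm⟩
  have hord : ∀ z ∈ ball (0 : ℂ) 1, _ := fun z hz =>
    order_coordRecip (r := r) hε hr.ne' (hh z hz) (hne z (ball_subset_closedBall hz))
  have hF : DiffContOnCl ℂ (fun z => coordRecip ε r (u z)) (ball 0 1) := by
    refine ⟨fun z hz => (hord z hz).1.differentiableWithinAt, ?_⟩
    rw [closure_ball _ one_ne_zero]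
    exact fun z hz => (continuousAt_coordRecip (hne z hz)).comp_continuousWithinAt (hc z hz)
  have hT := eq_zero_of_two_even_fibres hF (c := -r / ε) (T := Finset.univ.val.map b)
    (S := Finset.univ.val.map a) (fun z hz => by
      obtain ⟨w, hw, hwz⟩ := hbd z hz
      rw [← hwz, coordRecip_coe, norm_div, ← dist_eq_norm, mem_sphere.1 hw, Complex.norm_real,
        Real.norm_eq_abs, abs_of_pos hr, div_self hr.ne'])
    (div_ne_zero (neg_ne_zero.2 (by exact_mod_cast hr.ne')) hε)
    (by
      rw [norm_div, norm_neg, Complex.norm_real, Real.norm_eq_abs, abs_of_pos hr,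
        div_lt_one (hr.trans hrε)]
      exact hrε)
    (fun x hx => by obtain ⟨i, -, rfl⟩ := Multiset.mem_map.1 hx; exact hb i)
    (fun x hx => by obtain ⟨i, -, rfl⟩ := Multiset.mem_map.1 hx; exact ha i)
    (fun z hz => by rw [(hord z hz).2.1, hp z hz, count_map_univ])
    (fun z hzb => by rw [(hord z hzb).2.2, hz z hzb, count_map_univ])
  have := congrArg Multiset.card hT
  simp at this
  omega

/-! ### Homogeneous lifts over the disc -/

lemma ofHom_eq_iff {p q p' q' : ℂ} (h : p ≠ 0 ∨ q ≠ 0) (h' : p' ≠ 0 ∨ q' ≠ 0) :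
    ofHom p q = ofHom p' q' ↔ p * q' = p' * q := by
  by_cases hq : q = 0
  · by_cases hq' : q' = 0
    · simp [hq, hq']
    · rw [ofHom_of_ne hq', hq]
      simp_all
  · by_cases hq' : q' = 0
    · rw [ofHom_of_ne hq, hq']
      simp_all
    · rw [ofHom_of_ne hq, ofHom_of_ne hq', OnePoint.coe_eq_coe, div_eq_div_iff hq hq']

/-- The value 0 of `coordZero` at ∞ agrees with 0⁻¹ = 0, which is the normal form at a pole. -/
lemma HolomorphicAt.meromorphicNFAt_coordZero {u : ℂ → P1} {a : ℂ} (hu : HolomorphicAt u a) :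
    MeromorphicNFAt (fun z => coordZero (u z)) a := by
  rcases hu with ⟨g, hg, hug⟩ | ⟨g, hg, hug⟩
  · refine (meromorphicNFAt_congr ?_).2 hg.meromorphicNFAt
    filter_upwards [hug] with z hz
    simp [hz]
  · refine (meromorphicNFAt_congr ?_).2 hg.meromorphicNFAt.inv
    filter_upwards [hug] with z hz
    simp [hz]

/-- A meromorphic function on the disc without zeros and poles on the boundary circle is the
quotient of two holomorphic functions without common zeros, the denominator being a polynomial. -/
theorem IsMeromorphicDisc.exists_eq_ofHom {u : ℂ → P1} (hu : IsMeromorphicDisc u)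
    (hb : ∀ z ∈ sphere (0 : ℂ) 1, ∃ x : ℂ, x ≠ 0 ∧ u z = x) :
    ∃ (S T : Multiset ℂ) (G : ℂ → ℂ), (∀ a ∈ S, a ∈ ball (0 : ℂ) 1) ∧
      (∀ a ∈ T, a ∈ ball (0 : ℂ) 1) ∧ DiffContOnCl ℂ G (ball 0 1) ∧
      (∀ z ∈ closedBall (0 : ℂ) 1, G z ≠ 0) ∧
      IsHomLift u (fun z => G z * rootProd S z) (rootProd T) := by
  obtain ⟨hc, hh⟩ := hu
  obtain ⟨S, T, G, hS, hT, hST, hG, hG0, hs, hbl⟩ :=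
    exists_eq_mul_rootProd_div (f := fun z => coordZero (u z))
      (V := closedBall 0 1 ∩ u ⁻¹' {((0 : ℂ) : P1), OnePoint.infty})
      (fun z hz => (hh z hz).meromorphicNFAt_coordZero)
      ((isCompact_closedBall (0 : ℂ) 1).of_isClosed_subset
        (hc.preimage_isClosed_of_isClosed isClosed_closedBall (Set.toFinite _).isClosed)
        inter_subset_left)
      (fun z hz => by
        by_contra h
        obtain ⟨x, hx, hux⟩ := hb z (mem_sphere_of_not_mem_ball hz.1 h)
        rcases hz.2 with h | h <;> simp_all)
      (fun z hz h hz0 => h ⟨hz, by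
        rw [mem_preimage]
        generalize u z = p at hz0
        induction p using OnePoint.rec with
        | infty => simp
        | coe x => simpa using hz0⟩)
      (fun z hz => by
        obtain ⟨x, hx, hux⟩ := hb z hz
        refine ContinuousAt.comp_continuousWithinAt (g := coordZero) ?_
          (hc z (sphere_subset_closedBall hz))
        rw [hux, OnePoint.continuousAt_coe]
        exact continuousAt_id)
  have hne : ∀ z ∈ closedBall (0 : ℂ) 1, G z * rootProd S z ≠ 0 ∨ rootProd T z ≠ 0 := by
    intro z hz
    by_cases h : rootProd S z = 0
    · exact Or.inr fun h' => hST z (rootProd_eq_zero_iff.1 h) (rootProd_eq_zero_iff.1 h')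
    · exact Or.inl (mul_ne_zero (hG0 z hz) h)
  have hcont : ContinuousOn G (closedBall 0 1) := hG.continuousOn_ball
  refine ⟨S, T, G, hS, hT, hG, hG0, hcont.mul (continuous_rootProd S).continuousOn,
    (continuous_rootProd T).continuousOn, fun z hz => ⟨hne z hz, ?_⟩⟩
  by_cases hzb : z ∈ ball (0 : ℂ) 1
  · have hGc : ContinuousAt G z := (hG.analyticAt_of_mem hzb).continuousAt
    have hSc : ContinuousAt (rootProd S) z := (continuous_rootProd S).continuousAt
    have hTc : ContinuousAt (rootProd T) z := (continuous_rootProd T).continuousAt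
    rcases hh z hzb with ⟨g, hg, hug⟩ | ⟨g, hg, hug⟩
    -- The cross-multiplied identity holds on a punctured neighbourhood, and continuity carries it
    -- to z, which may be a zero or a pole.
    · have key : g z * rootProd T z = G z * rootProd S z := by
        refine tendsto_nhds_unique
          ((hg.continuousAt.mul hTc : Tendsto _ _ _).mono_left nhdsWithin_le_nhds)
          (((hGc.mul hSc : Tendsto _ _ _).mono_left nhdsWithin_le_nhds).congr' (l₁ := 𝓝[≠] z) ?_)
        filter_upwards [hbl z hzb, hug.filter_mono nhdsWithin_le_nhds,
          eventually_rootProd_ne_zero T z] with x hx hux hTx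
        rw [hux, ofHom_one_right, coordZero_coe] at hx
        simp only [Pi.mul_apply, hx]; field_simp
      rw [hug.self_of_nhds, ofHom_eq_iff (Or.inr one_ne_zero) (hne z hz), key, mul_one]
    · have key : g z * (G z * rootProd S z) = rootProd T z := by
        refine tendsto_nhds_unique
          ((hg.continuousAt.mul (hGc.mul hSc) : Tendsto _ _ _).mono_left nhdsWithin_le_nhds)
          (((hTc : Tendsto _ _ _).mono_left nhdsWithin_le_nhds).congr' (l₁ := 𝓝[≠] z) ?_)
        filter_upwards [hbl z hzb, hug.filter_mono nhdsWithin_le_nhds,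
          eventually_rootProd_ne_zero T z, eventually_rootProd_ne_zero S z,
          (hGc.eventually_ne (hG0 z hz)).filter_mono nhdsWithin_le_nhds] with x hx hux hTx hSx hGx
        rw [hux, coordZero_ofHom] at hx
        have hgx : g x ≠ 0 := by
          rintro h
          rw [h, div_zero] at hx
          exact div_ne_zero (mul_ne_zero hGx hSx) hTx hx.symm
        simp only [Pi.mul_apply]
        field_simp at hx
        linear_combination hx
      rw [hug.self_of_nhds, ofHom_eq_iff (Or.inl one_ne_zero) (hne z hz), one_mul, ← key]
      ring
  · have hzs := mem_sphere_of_not_mem_ball hz hzb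
    obtain ⟨x, hx, hux⟩ := hb z hzs
    have := hs z hzs
    rw [hux, coordZero_coe] at this
    rw [hux, this, ofHom_of_ne (rootProd_ne_zero_of_mem_sphere hT hzs)]

/-- The factor is the Hermitian projection of (p, q) onto the line spanned by (P, Q), hence
continuous. Consequently the winding number of q does not depend on the lift used for the Maslov
index. -/
lemma IsHomLift.exists_scale {u : ℂ → P1} {p q P Q : ℂ → ℂ} (h : IsHomLift u p q)
    (h' : IsHomLift u P Q) : ∃ γ : ℂ → ℂ, ContinuousOn γ (closedBall 0 1) ∧
      (∀ z ∈ closedBall (0 : ℂ) 1, γ z ≠ 0) ∧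
      ∀ z ∈ closedBall (0 : ℂ) 1, p z = γ z * P z ∧ q z = γ z * Q z := by
  obtain ⟨hp, hq, hu⟩ := h
  obtain ⟨hP, hQ, hU⟩ := h'
  have hN : ∀ z ∈ closedBall (0 : ℂ) 1, P z * conj (P z) + Q z * conj (Q z) ≠ 0 := by
    intro z hz h0
    rw [Complex.mul_conj', Complex.mul_conj'] at h0
    have h1 : ‖P z‖ ^ 2 + ‖Q z‖ ^ 2 = 0 := by exact_mod_cast h0
    have h2 : ‖P z‖ = 0 := by nlinarith [sq_nonneg ‖P z‖, sq_nonneg ‖Q z‖]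
    have h3 : ‖Q z‖ = 0 := by nlinarith [sq_nonneg ‖P z‖, sq_nonneg ‖Q z‖]
    rcases (hU z hz).1 with h | h
    · exact h (norm_eq_zero.1 h2)
    · exact h (norm_eq_zero.1 h3)
  have hs : ∀ z ∈ closedBall (0 : ℂ) 1, p z * Q z = P z * q z := fun z hz =>
    (ofHom_eq_iff (hu z hz).1 (hU z hz).1).1 ((hu z hz).2.symm.trans (hU z hz).2)
  set γ : ℂ → ℂ := fun z => (p z * conj (P z) + q z * conj (Q z)) /
    (P z * conj (P z) + Q z * conj (Q z)) with hγ
  have hscale : ∀ z ∈ closedBall (0 : ℂ) 1, p z = γ z * P z ∧ q z = γ z * Q z := by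
    intro z hz
    have hNz := hN z hz
    simp only [hγ]
    rw [div_mul_eq_mul_div, div_mul_eq_mul_div, eq_div_iff hNz, eq_div_iff hNz]
    exact ⟨by linear_combination conj (Q z) * hs z hz, by linear_combination -conj (P z) * hs z hz⟩
  have hcj : Continuous (conj : ℂ → ℂ) := Complex.continuous_conj
  refine ⟨γ, ContinuousOn.div (by fun_prop) (by fun_prop) hN, fun z hz h0 => ?_, hscale⟩
  have := hscale z hz
  rw [h0, zero_mul, zero_mul] at this
  rcases (hu z hz).1 with h | h
  · exact h this.1
  · exact h this.2

end P1

/-! ### Continuous logarithms and winding numbers -/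

/-- A continuous zero-free function on the closed disc has a continuous logarithm. -/
theorem exists_continuousOn_log {F : ℂ → ℂ} (hF : ContinuousOn F (closedBall 0 1))
    (h0 : ∀ z ∈ closedBall (0 : ℂ) 1, F z ≠ 0) :
    ∃ l : ℂ → ℂ, ContinuousOn l (closedBall 0 1) ∧
      ∀ z ∈ closedBall (0 : ℂ) 1, Complex.exp (l z) = F z := by
  have hK : IsCompact (closedBall (0 : ℂ) 1) := isCompact_closedBall 0 1
  obtain ⟨z₀, hz₀, hmin⟩ := hK.exists_isMinOn ⟨0, by simp⟩ hF.norm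
  have hm : 0 < ‖F z₀‖ := norm_pos_iff.2 (h0 z₀ hz₀)
  have hmin' : ∀ z ∈ closedBall (0 : ℂ) 1, ‖F z₀‖ ≤ ‖F z‖ := fun z hz => hmin hz
  obtain ⟨δ, hδ, hunif⟩ := Metric.uniformContinuousOn_iff.1
    (hK.uniformContinuousOn_of_continuous hF) _ hm
  obtain ⟨n, hn⟩ := exists_nat_one_div_lt hδ
  set N : ℕ := n + 1 with hN
  have hNpos : (0 : ℝ) < N := by positivity
  have hn' : 1 / (N : ℝ) < δ := by simpa [hN] using hn
  set x : ℕ → ℂ → ℂ := fun j z => ((j / N : ℝ) : ℂ) * z with hx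
  have hxmem : ∀ j ≤ N, ∀ z ∈ closedBall (0 : ℂ) 1, x j z ∈ closedBall (0 : ℂ) 1 := by
    intro j hj z hz
    rw [mem_closedBall_zero_iff] at hz ⊢
    rw [hx, norm_mul, Complex.norm_real, Real.norm_eq_abs, abs_of_nonneg (by positivity)]
    have : (j : ℝ) / N ≤ 1 := (div_le_one hNpos).2 (by exact_mod_cast hj)
    exact mul_le_one₀ this (norm_nonneg z) hz
  -- Along each radius, one step of the subdivision changes F by less than its minimal modulus, so
  -- the ratio is within distance 1 of 1. The principal logarithms of the ratios then add up to a
  -- logarithm of F.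
  have hratio : ∀ j < N, ∀ z ∈ closedBall (0 : ℂ) 1,
      F (x (j + 1) z) / F (x j z) ∈ Complex.slitPlane := by
    intro j hj z hz
    have h1 := hxmem j hj.le z hz
    have h2 := hxmem (j + 1) hj z hz
    have hd : dist (x (j + 1) z) (x j z) < δ := by
      have : x (j + 1) z - x j z = ((1 / N : ℝ) : ℂ) * z := by
        simp only [hx]; push_cast; ring
      rw [dist_eq_norm, this, norm_mul, Complex.norm_real, Real.norm_eq_abs,
        abs_of_nonneg (by positivity)]
      rw [mem_closedBall_zero_iff] at hz
      exact (mul_le_of_le_one_right (by positivity) hz).trans_lt hn'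
    have h3 := hunif _ h2 _ h1 hd
    rw [dist_eq_norm] at h3
    have h4 : ‖F (x (j + 1) z) / F (x j z) - 1‖ < 1 := by
      rw [div_sub_one (h0 _ h1), norm_div, div_lt_one (norm_pos_iff.2 (h0 _ h1))]
      exact h3.trans_le (hmin' _ h1)
    have := Complex.mem_slitPlane_of_norm_lt_one h4
    simpa using this
  have hxc : ∀ j, Continuous (x j) := fun j => by simp only [hx]; fun_prop
  have hFx : ∀ j ≤ N, ContinuousOn (fun z => F (x j z)) (closedBall 0 1) := fun j hj =>
    hF.comp (hxc j).continuousOn (hxmem j hj)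
  refine ⟨fun z => Complex.log (F 0) + ∑ j ∈ Finset.range N,
    Complex.log (F (x (j + 1) z) / F (x j z)), ?_, fun z hz => ?_⟩
  · refine continuousOn_const.add (continuousOn_finsetSum _ fun j hj => ?_)
    have hj' := Finset.mem_range.1 hj
    exact ((hFx (j + 1) hj').div (hFx j hj'.le)
      fun z hz => h0 _ (hxmem j hj'.le z hz)).clog (hratio j hj')
  · have h00 : F 0 ≠ 0 := h0 0 (by simp)
    rw [Complex.exp_add, Complex.exp_log h00, Complex.exp_sum,
      Finset.prod_congr rfl fun j hj => Complex.exp_log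
        (Complex.slitPlane_ne_zero (hratio j (Finset.mem_range.1 hj) z hz))]
    have htel : ∀ M ≤ N, F 0 * ∏ j ∈ Finset.range M, F (x (j + 1) z) / F (x j z) = F (x M z) := by
      intro M
      induction M with
      | zero => intro _; simp [hx]
      | succ M ih =>
        intro hM
        rw [Finset.prod_range_succ, ← mul_assoc, ih (by omega)]
        exact mul_div_cancel₀ _ (h0 _ (hxmem M (by omega) z hz))
    rw [htel N le_rfl]
    simp [hx]

/-- On the unit circle, `φ` is `z ^ k` times a function that extends to a continuous zero-free
function on the disc; hence `φ` has winding number `k`. -/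
def HasDegree (φ : ℂ → ℂ) (k : ℤ) : Prop :=
  ∃ F : ℂ → ℂ, ContinuousOn F (closedBall 0 1) ∧ (∀ z ∈ closedBall (0 : ℂ) 1, F z ≠ 0) ∧
    ∀ z ∈ sphere (0 : ℂ) 1, φ z = z ^ k * F z

lemma ne_zero_of_mem_sphere_one {z : ℂ} (hz : z ∈ sphere (0 : ℂ) 1) : z ≠ 0 := by
  rintro rfl; simp at hz

namespace HasDegree

variable {φ ψ : ℂ → ℂ} {k l : ℤ}

lemma of_ne_zero (hF : ContinuousOn φ (closedBall 0 1))
    (h0 : ∀ z ∈ closedBall (0 : ℂ) 1, φ z ≠ 0) : HasDegree φ 0 :=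
  ⟨φ, hF, h0, fun z _ => by simp⟩

lemma mul (h : HasDegree φ k) (h' : HasDegree ψ l) :
    HasDegree (fun z => φ z * ψ z) (k + l) := by
  obtain ⟨F, hF, hF0, hφ⟩ := h
  obtain ⟨G, hG, hG0, hψ⟩ := h'
  refine ⟨fun z => F z * G z, hF.mul hG, fun z hz => mul_ne_zero (hF0 z hz) (hG0 z hz),
    fun z hz => ?_⟩
  beta_reduce
  rw [hφ z hz, hψ z hz, zpow_add₀ (ne_zero_of_mem_sphere_one hz)]
  ring

lemma inv (h : HasDegree φ k) : HasDegree (fun z => (φ z)⁻¹) (-k) := by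
  obtain ⟨F, hF, hF0, hφ⟩ := h
  refine ⟨fun z => (F z)⁻¹, hF.inv₀ hF0, fun z hz => inv_ne_zero (hF0 z hz), fun z hz => ?_⟩
  beta_reduce
  rw [hφ z hz, zpow_neg, mul_inv]

lemma pow (h : HasDegree φ k) (n : ℕ) : HasDegree (fun z => φ z ^ n) (n * k) := by
  obtain ⟨F, hF, hF0, hφ⟩ := h
  refine ⟨fun z => F z ^ n, hF.pow n, fun z hz => pow_ne_zero n (hF0 z hz), fun z hz => ?_⟩
  beta_reduce
  rw [hφ z hz, mul_pow, ← zpow_natCast, ← zpow_mul, mul_comm k]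

lemma congr (h : HasDegree φ k) (hψ : ∀ z ∈ sphere (0 : ℂ) 1, ψ z = φ z) : HasDegree ψ k := by
  obtain ⟨F, hF, hF0, hφ⟩ := h
  exact ⟨F, hF, hF0, fun z hz => (hψ z hz).trans (hφ z hz)⟩

lemma rootProd {S : Multiset ℂ} (hS : ∀ a ∈ S, a ∈ ball (0 : ℂ) 1) :
    HasDegree (rootProd S) (Multiset.card S) := by
  induction S using Multiset.induction_on with
  | empty =>
    exact (of_ne_zero continuousOn_const (fun _ _ => one_ne_zero)).congr fun z _ => by simp
  | cons a S ih =>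
    have ha : HasDegree (fun z => z - a) 1 := by
      have hcj : Continuous (conj : ℂ → ℂ) := Complex.continuous_conj
      -- On the circle z - a = z · conj(1 - ā z). The second factor is not holomorphic, but it is
      -- continuous and zero-free on the closed disc.
      refine ⟨fun z => conj (1 - conj a * z), by fun_prop, fun z hz => ?_, fun z hz => ?_⟩
      · rw [Ne, map_eq_zero]
        exact one_sub_conj_mul_ne_zero (by simpa using hS a (Multiset.mem_cons_self a S))
          (by simpa using hz)
      · have h1 : z * conj z = 1 := by
          rw [Complex.mul_conj']; rw [mem_sphere_zero_iff_norm] at hz; simp [hz]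
        simp only [map_sub, map_mul, map_one, Complex.conj_conj, zpow_one]
        linear_combination a * h1
    have := (ha.mul (ih fun b hb => hS b (Multiset.mem_cons_of_mem hb))).congr
      (ψ := _root_.rootProd (a ::ₘ S)) fun z _ => by simp
    rwa [Multiset.card_cons, Nat.cast_succ, add_comm]

/-- A function on the circle with a continuous single-valued argument has degree zero. -/
theorem eq_zero (h : HasDegree φ k) {θ : ℝ → ℝ} (hθ : Continuous θ)
    (hper : θ (2 * Real.pi) = θ 0)
    (harg : ∀ t : ℝ, ∃ c : ℝ, 0 < c ∧
      φ (Complex.exp (t * Complex.I)) = c * Complex.exp (θ t * Complex.I)) : k = 0 := by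
  obtain ⟨F, hF, hF0, hφ⟩ := h
  obtain ⟨l, hl, hlF⟩ := exists_continuousOn_log hF hF0
  have hmem : ∀ t : ℝ, Complex.exp (t * Complex.I) ∈ sphere (0 : ℂ) 1 := fun t => by
    rw [mem_sphere_zero_iff_norm, Complex.norm_exp_ofReal_mul_I]
  have hlc : Continuous fun t : ℝ => l (Complex.exp (t * Complex.I)) :=
    hl.comp_continuous (by fun_prop) fun t => sphere_subset_closedBall (hmem t)
  -- The difference of two arguments of the same number, in units of 2π: integer-valued and
  -- continuous, hence constant. Its increment over one turn is k.
  set ψ : ℝ → ℝ := fun t => (k * t + (l (Complex.exp (t * Complex.I))).im - θ t) / (2 * Real.pi)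
    with hψ
  have hψc : Continuous ψ := by
    have := Complex.continuous_im.comp hlc
    simp only [Function.comp_def] at this
    fun_prop
  have hint : ∀ t, ψ t ∈ Set.range ((↑) : ℤ → ℝ) := by
    intro t
    obtain ⟨c, hc, hct⟩ := harg t
    rw [hφ _ (hmem t), ← hlF _ (sphere_subset_closedBall (hmem t)), ← Complex.exp_int_mul,
      ← Complex.exp_add, ← Complex.exp_log (x := (c : ℂ)) (by exact_mod_cast hc.ne'),
      ← Complex.exp_add, Complex.exp_eq_exp_iff_exists_int] at hct
    obtain ⟨n, hn⟩ := hct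
    refine ⟨n, ?_⟩
    have := congrArg Complex.im hn
    rw [← Complex.ofReal_log hc.le] at this
    simp at this
    rw [hψ, eq_div_iff (by positivity)]
    linarith
  have hdisc : DiscreteTopology (Set.range ((↑) : ℤ → ℝ)) :=
    (Int.isClosedEmbedding_coe_real.toIsEmbedding.toHomeomorph).symm.isEmbedding.discreteTopology
  have hconst : ψ (2 * Real.pi) = ψ 0 := by
    have hmaps : MapsTo ψ univ (Set.range ((↑) : ℤ → ℝ)) := fun t _ => hint t
    have := isPreconnected_univ.constant_of_mapsTo (f := ψ) ⟨hdisc⟩ hψc.continuousOn hmaps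
      (mem_univ (2 * Real.pi)) (mem_univ 0)
    exact this
  simp only [hψ] at hconst
  rw [div_left_inj' (by positivity), hper] at hconst
  have he : Complex.exp (((2 * Real.pi : ℝ) : ℂ) * Complex.I) =
      Complex.exp (((0 : ℝ) : ℂ) * Complex.I) := by
    push_cast; rw [Complex.exp_two_pi_mul_I]; simp
  rw [he] at hconst
  have : (k : ℝ) * (2 * Real.pi) = 0 := by linarith
  rcases mul_eq_zero.1 this with h | h
  · exact_mod_cast h
  · exact absurd h (by positivity)

end HasDegree

/-! ### The tangent planes of the torus -/

/-- On L both f' and 0 are derivatives of f, and derivatives within a set agree on its tangent cone.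
-/
lemma eq_zero_of_mem_tangentConeAt {E : Type*} [NormedAddCommGroup E] [NormedSpace ℝ E]
    {L : Set E} {f : E → ℝ} {f' : E →L[ℝ] ℝ} {x : E} {c : ℝ} (hf : HasFDerivAt f f' x)
    (hc : ∀ y ∈ L, f y = c) (hx : x ∈ L) {v : E} (hv : v ∈ tangentConeAt ℝ L x) : f' v = 0 :=
  hf.hasFDerivWithinAt.unique_on
    ((hasFDerivWithinAt_const c x L).congr hc (hc x hx)) hv

section Tangent

variable {ε : ℂ} {r lam : ℝ} {x v w : ℂ × ℂ}

lemma ne_zero_of_mem_liftedChekanovTorus (hrε : r < ‖ε‖) (hx : x ∈ liftedChekanovTorus ε r lam) :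
    x.1 ≠ 0 ∧ x.2 ≠ 0 := by
  have h := hx.1
  constructor
  · intro h0
    rw [h0] at h; simp at h; exact hrε.ne' h
  · intro h0
    rw [h0] at h; simp at h; exact hrε.ne' h

/-- These are the linearizations of the two defining equations. Constancy of |w - ε| makes dw(v)/(w
- ε) purely imaginary, where w = x₁² x₂. -/
lemma exists_of_mem_tangentConeAt (hr : 0 < r) (hx : x ∈ liftedChekanovTorus ε r lam)
    (hv : v ∈ tangentConeAt ℝ (liftedChekanovTorus ε r lam) x) :
    (∃ t : ℝ, 2 * x.1 * x.2 * v.1 + x.1 ^ 2 * v.2 = Complex.I * t * (x.1 ^ 2 * x.2 - ε)) ∧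
      2 * ‖x.1‖ ^ 2 * (v.1 * conj x.1).re = (v.2 * conj x.2).re := by
  have h1 : HasFDerivAt (fun y : ℂ × ℂ => y.1) (ContinuousLinearMap.fst ℝ ℂ ℂ) x :=
    hasFDerivAt_fst
  have h2 : HasFDerivAt (fun y : ℂ × ℂ => y.2) (ContinuousLinearMap.snd ℝ ℂ ℂ) x :=
    hasFDerivAt_snd
  constructor
  · have h := (((h1.mul h1).mul h2).sub_const ε).norm_sq
    have h0 := eq_zero_of_mem_tangentConeAt (c := r ^ 2) h (L := liftedChekanovTorus ε r lam)
      (fun y hy => by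
        have := hy.1
        rw [pow_two] at this
        simp only [Pi.mul_apply, this]) hx hv
    simp [Complex.inner] at h0
    have hne : x.1 ^ 2 * x.2 - ε ≠ 0 := by
      rw [← norm_pos_iff, hx.1]; exact hr
    refine ⟨((2 * x.1 * x.2 * v.1 + x.1 ^ 2 * v.2) / (x.1 ^ 2 * x.2 - ε)).im, ?_⟩
    have hre : ((2 * x.1 * x.2 * v.1 + x.1 ^ 2 * v.2) * conj (x.1 ^ 2 * x.2 - ε)).re = 0 := by
      simp [pow_two]
      linarith
    have hq : ((2 * x.1 * x.2 * v.1 + x.1 ^ 2 * v.2) / (x.1 ^ 2 * x.2 - ε)).re = 0 := by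
      rw [Complex.mul_re, Complex.conj_re, Complex.conj_im] at hre
      rw [Complex.div_re, ← add_div, div_eq_zero_iff]
      left
      linarith
    rw [← div_eq_iff hne]
    apply Complex.ext
    · rw [hq]; simp
    · simp
  · have h := ((h1.norm_sq.pow 2).sub h2.norm_sq)
    have h0 := eq_zero_of_mem_tangentConeAt (c := lam) h (L := liftedChekanovTorus ε r lam)
      (fun y hy => by
        rw [← hy.2]; simp; ring) hx hv
    simp [Complex.inner] at h0
    rw [Complex.mul_re, Complex.mul_re]
    simp only [Complex.conj_re, Complex.conj_im]
    linarith

/-- The complex determinant of two tangent vectors of the torus has the argument of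
`(x₁² x₂ - ε) / x₁` up to sign. -/
lemma exists_real_det_eq (hr : 0 < r) (hrε : r < ‖ε‖) (hx : x ∈ liftedChekanovTorus ε r lam)
    (hv : v ∈ tangentConeAt ℝ (liftedChekanovTorus ε r lam) x)
    (hw : w ∈ tangentConeAt ℝ (liftedChekanovTorus ε r lam) x) :
    ∃ ρ : ℝ, v.1 * w.2 - v.2 * w.1 = ρ * ((x.1 ^ 2 * x.2 - ε) / x.1) := by
  obtain ⟨h1, h2⟩ := ne_zero_of_mem_liftedChekanovTorus hrε hx
  have hn1 : 0 < ‖x.1‖ := norm_pos_iff.2 h1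
  have hn2 : 0 < ‖x.2‖ := norm_pos_iff.2 h2
  set W := x.1 ^ 2 * x.2 - ε with hW
  -- Dividing the first equation by x₁² x₂ expresses y₂/x₂ through t and y₁/x₁. The second equation
  -- then determines Re(y₁/x₁) as t times a constant depending on x alone.
  have key : ∀ y : ℂ × ℂ, ∀ t : ℝ, 2 * x.1 * x.2 * y.1 + x.1 ^ 2 * y.2 = Complex.I * t * W →
      2 * ‖x.1‖ ^ 2 * (y.1 * conj x.1).re = (y.2 * conj x.2).re →
      (y.1 / x.1).re = t * (‖x.2‖ ^ 2 * (Complex.I * (W / (x.1 ^ 2 * x.2))).re /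
        (2 * ‖x.1‖ ^ 4 + 2 * ‖x.2‖ ^ 2)) := by
    intro y t hD hy
    have e1 : y.1 * conj x.1 = ((‖x.1‖ ^ 2 : ℝ) : ℂ) * (y.1 / x.1) := by
      push_cast
      rw [← Complex.mul_conj']; field_simp
    have e2 : y.2 * conj x.2 = ((‖x.2‖ ^ 2 : ℝ) : ℂ) *
        ((t : ℂ) * (Complex.I * (W / (x.1 ^ 2 * x.2))) - ((2 : ℝ) : ℂ) * (y.1 / x.1)) := by
      push_cast
      rw [← Complex.mul_conj']
      field_simp
      linear_combination conj x.2 * hD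
    rw [e1, e2, Complex.re_ofReal_mul, Complex.re_ofReal_mul, Complex.sub_re,
      Complex.re_ofReal_mul, Complex.re_ofReal_mul] at hy
    rw [← mul_div_assoc, eq_div_iff (by positivity)]
    linear_combination hy
  obtain ⟨⟨tv, hDv⟩, hcv⟩ := exists_of_mem_tangentConeAt hr hx hv
  obtain ⟨⟨tw, hDw⟩, hcw⟩ := exists_of_mem_tangentConeAt hr hx hw
  have hαv := key v tv hDv hcv
  have hαw := key w tw hDw hcw
  refine ⟨-(tw * (v.1 / x.1).im - tv * (w.1 / x.1).im), ?_⟩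
  -- By `key` the real parts of v₁/x₁ and w₁/x₁ are proportional to `tv` and `tw` with the same
  -- constant, so they cancel in this combination.
  have hI : Complex.I * (tw * (v.1 / x.1) - tv * (w.1 / x.1)) =
      ((-(tw * (v.1 / x.1).im - tv * (w.1 / x.1).im) : ℝ) : ℂ) := by
    apply Complex.ext
    · simp
    · rw [Complex.I_mul_im, Complex.sub_re, Complex.re_ofReal_mul, Complex.re_ofReal_mul, hαv, hαw,
        Complex.ofReal_im]
      ring
  rw [← hI]
  rw [← mul_right_inj' (pow_ne_zero 2 h1)]
  field_simp
  linear_combination v.1 * hDw - w.1 * hDv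

end Tangent

/-! ### The Maslov index and constancy of index zero discs -/

/-- A function on the circle with values in a closed disc that does not contain `0` has degree
zero. -/
lemma HasDegree.eq_zero_of_mem_closedBall {φ : ℂ → ℂ} {k : ℤ} (h : HasDegree φ k) {ε : ℂ} {r : ℝ}
    (hrε : r < ‖ε‖) (hφ : ContinuousOn φ (sphere 0 1))
    (hb : ∀ z ∈ sphere (0 : ℂ) 1, ‖φ z - ε‖ ≤ r) : k = 0 := by
  have hε : ε ≠ 0 := by
    rintro rfl
    have := hb 1 (by simp)
    rw [norm_zero] at hrε
    linarith [norm_nonneg (φ 1 - 0)]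
  have hmem : ∀ t : ℝ, Complex.exp (t * Complex.I) ∈ sphere (0 : ℂ) 1 := fun t => by
    rw [mem_sphere_zero_iff_norm, Complex.norm_exp_ofReal_mul_I]
  have hslit : ∀ z ∈ sphere (0 : ℂ) 1, φ z / ε ∈ Complex.slitPlane := by
    intro z hz
    have h4 : ‖φ z / ε - 1‖ < 1 := by
      rw [div_sub_one hε, norm_div, div_lt_one (norm_pos_iff.2 hε)]
      exact (hb z hz).trans_lt hrε
    simpa using Complex.mem_slitPlane_of_norm_lt_one h4
  have hc : Continuous fun t : ℝ => Complex.log (φ (Complex.exp (t * Complex.I)) / ε) :=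
    ((hφ.comp_continuous (by fun_prop) hmem).div_const ε).clog fun t => hslit _ (hmem t)
  refine h.eq_zero
    (θ := fun t => (Complex.log (φ (Complex.exp (t * Complex.I)) / ε)).im + ε.arg)
    ((Complex.continuous_im.comp hc).add continuous_const) ?_ fun t => ?_
  · have he : Complex.exp (((2 * Real.pi : ℝ) : ℂ) * Complex.I) =
        Complex.exp (((0 : ℝ) : ℂ) * Complex.I) := by
      push_cast; rw [Complex.exp_two_pi_mul_I]; simp
    simp only [he]
  · have h0 := Complex.slitPlane_ne_zero (hslit _ (hmem t))
    refine ⟨‖φ (Complex.exp (t * Complex.I)) / ε‖ * ‖ε‖,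
      mul_pos (norm_pos_iff.2 h0) (norm_pos_iff.2 hε), ?_⟩
    rw [Complex.log_im]
    push_cast
    rw [add_mul, Complex.exp_add]
    set q := φ (Complex.exp (t * Complex.I)) / ε with hq
    calc φ (Complex.exp (t * Complex.I)) = q * ε := by rw [hq]; field_simp
      _ = (‖q‖ * Complex.exp (q.arg * Complex.I)) * (‖ε‖ * Complex.exp (ε.arg * Complex.I)) := by
        rw [Complex.norm_mul_exp_arg_mul_I, Complex.norm_mul_exp_arg_mul_I]
      _ = _ := by ring

theorem not_isIndexZeroDisc {ε : ℂ} {r lam : ℝ} (hr : 0 < r) (hrε : r < ‖ε‖) (u : ℂ → P1 × P1) :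
    ¬ IsIndexZeroDisc (liftedChekanovTorus ε r lam) u := by
  rintro ⟨⟨hu1, hu2, hub⟩, ⟨y, hy, y', hy', hyy⟩, p₁, q₁, p₂, q₂, hl1, hl2, θ, hθ, hθper, hdet⟩
  have hε : ε ≠ 0 := norm_pos_iff.1 (hr.trans hrε)
  have hr0 : (r : ℂ) ≠ 0 := by exact_mod_cast hr.ne'
  obtain ⟨S₁, T₁, G₁, hS₁, hT₁, hG₁, hG₁0, hL₁⟩ := hu1.exists_eq_ofHom fun z hz => by
    obtain ⟨x, hx, hxz⟩ := hub z hz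
    exact ⟨x.1, (ne_zero_of_mem_liftedChekanovTorus hrε hx).1, congrArg Prod.fst hxz.symm⟩
  obtain ⟨S₂, T₂, G₂, hS₂, hT₂, hG₂, hG₂0, hL₂⟩ := hu2.exists_eq_ofHom fun z hz => by
    obtain ⟨x, hx, hxz⟩ := hub z hz
    exact ⟨x.2, (ne_zero_of_mem_liftedChekanovTorus hrε hx).2, congrArg Prod.snd hxz.symm⟩
  set P₁ : ℂ → ℂ := fun z => G₁ z * rootProd S₁ z with hP₁
  set P₂ : ℂ → ℂ := fun z => G₂ z * rootProd S₂ z with hP₂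
  have hP₁D : DiffContOnCl ℂ P₁ (ball 0 1) := hG₁.fun_mul (diffContOnCl_rootProd S₁)
  have hP₂D : DiffContOnCl ℂ P₂ (ball 0 1) := hG₂.fun_mul (diffContOnCl_rootProd S₂)
  have hQ₁ : ∀ z ∈ sphere (0 : ℂ) 1, rootProd T₁ z ≠ 0 := fun z hz =>
    rootProd_ne_zero_of_mem_sphere hT₁ hz
  have hQ₂ : ∀ z ∈ sphere (0 : ℂ) 1, rootProd T₂ z ≠ 0 := fun z hz =>
    rootProd_ne_zero_of_mem_sphere hT₂ hz
  have hbd : ∀ z ∈ sphere (0 : ℂ) 1, ∀ x ∈ liftedChekanovTorus ε r lam, u z = affinePoint x →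
      x.1 = P₁ z / rootProd T₁ z ∧ x.2 = P₂ z / rootProd T₂ z := by
    intro z hz x hx hxz
    have h1 := (hL₁.2.2 z (sphere_subset_closedBall hz)).2
    have h2 := (hL₂.2.2 z (sphere_subset_closedBall hz)).2
    simp only [hxz, affinePoint] at h1 h2
    rw [P1.ofHom_of_ne (hQ₁ z hz)] at h1
    rw [P1.ofHom_of_ne (hQ₂ z hz)] at h2
    exact ⟨OnePoint.coe_injective h1, OnePoint.coe_injective h2⟩
  have hmemL : ∀ z ∈ sphere (0 : ℂ) 1,
      (P₁ z / rootProd T₁ z, P₂ z / rootProd T₂ z) ∈ liftedChekanovTorus ε r lam := by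
    intro z hz
    obtain ⟨x, hx, hxz⟩ := hub z hz
    obtain ⟨h1, h2⟩ := hbd z hz x hx hxz.symm
    rw [← h1, ← h2]; exact hx
  -- The function `w - ε`, where `w = z₁² z₂`, after clearing denominators.
  set H : ℂ → ℂ := fun z =>
    P₁ z ^ 2 * P₂ z - ε * (rootProd T₁ z ^ 2 * rootProd T₂ z) with hH
  have hHD : DiffContOnCl ℂ H (ball 0 1) :=
    ((hP₁D.fun_pow 2).fun_mul hP₂D).sub (diffContOnCl_const.fun_mul
      (((diffContOnCl_rootProd T₁).fun_pow 2).fun_mul (diffContOnCl_rootProd T₂)))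
  have hHW : ∀ z ∈ sphere (0 : ℂ) 1,
      (P₁ z / rootProd T₁ z) ^ 2 * (P₂ z / rootProd T₂ z) - ε =
        H z / (rootProd T₁ z ^ 2 * rootProd T₂ z) := by
    intro z hz
    have := hQ₁ z hz
    have := hQ₂ z hz
    simp only [hH]
    field_simp
  have hHnorm : ∀ z ∈ sphere (0 : ℂ) 1, ‖H z / (rootProd T₁ z ^ 2 * rootProd T₂ z)‖ = r :=
    fun z hz => by rw [← hHW z hz]; exact (hmemL z hz).1
  have hH0 : ∀ z ∈ sphere (0 : ℂ) 1, H z ≠ 0 := by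
    intro z hz h0
    have := hHnorm z hz
    rw [h0, zero_div, norm_zero] at this
    exact hr.ne this
  obtain ⟨R, g, hR, hg, hg0, hHg⟩ := hHD.exists_eq_mul_rootProd hH0
  -- Degrees along the boundary circle.
  have dP₁ : HasDegree P₁ (Multiset.card S₁) := by
    simpa using (HasDegree.of_ne_zero hG₁.continuousOn_ball hG₁0).mul (.rootProd hS₁)
  have dP₂ : HasDegree P₂ (Multiset.card S₂) := by
    simpa using (HasDegree.of_ne_zero hG₂.continuousOn_ball hG₂0).mul (.rootProd hS₂)
  have dQ₁ : HasDegree (rootProd T₁) (Multiset.card T₁) := .rootProd hT₁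
  have dQ₂ : HasDegree (rootProd T₂) (Multiset.card T₂) := .rootProd hT₂
  have dH : HasDegree H (Multiset.card R) := by
    have : HasDegree (fun z => g z * rootProd R z) (Multiset.card R) := by
      simpa using (HasDegree.of_ne_zero hg.continuousOn_ball hg0).mul (.rootProd hR)
    exact this.congr fun z hz => hHg z (sphere_subset_closedBall hz)
  have dq₁ : HasDegree q₁ (Multiset.card T₁) := by
    obtain ⟨γ, hγ, hγ0, hs⟩ := hl1.exists_scale hL₁
    have := ((HasDegree.of_ne_zero hγ hγ0).mul dQ₁).congr (ψ := q₁)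
      fun z hz => (hs z (sphere_subset_closedBall hz)).2
    simpa using this
  have dq₂ : HasDegree q₂ (Multiset.card T₂) := by
    obtain ⟨γ, hγ, hγ0, hs⟩ := hl2.exists_scale hL₂
    have := ((HasDegree.of_ne_zero hγ hγ0).mul dQ₂).congr (ψ := q₂)
      fun z hz => (hs z (sphere_subset_closedBall hz)).2
    simpa using this
  have hP₁c : ContinuousOn P₁ (sphere 0 1) := hP₁D.continuousOn_ball.mono sphere_subset_closedBall
  have hP₂c : ContinuousOn P₂ (sphere 0 1) := hP₂D.continuousOn_ball.mono sphere_subset_closedBall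
  have hw := ((((dP₁.mul dQ₁.inv).pow 2).mul (dP₂.mul dQ₂.inv))).eq_zero_of_mem_closedBall
    (ε := ε) hrε
    ((((hP₁c.mul ((continuous_rootProd T₁).continuousOn.inv₀ hQ₁)).pow 2).mul
      (hP₂c.mul ((continuous_rootProd T₂).continuousOn.inv₀ hQ₂))))
    (fun z hz => (hmemL z hz).1.le)
  -- The squared determinant in the trivialization, up to a positive factor: q₁² q₂² times (w -
  -- ε)/z₁, where w - ε = H/(Q₁² Q₂) and z₁ = P₁/Q₁.
  have hmas := (((dq₁.pow 2).mul (dq₂.pow 2)).mul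
    ((dH.mul ((dQ₁.pow 2).mul dQ₂).inv).mul (dP₁.mul dQ₁.inv).inv)).pow 2
  have hmas0 := hmas.eq_zero hθ (by simpa [sub_eq_zero] using hθper) fun t => by
    have hz : Complex.exp (t * Complex.I) ∈ sphere (0 : ℂ) 1 := by
      rw [mem_sphere_zero_iff_norm, Complex.norm_exp_ofReal_mul_I]
    obtain ⟨x, hx, hux, v, hv, w, hw, c, hc, hcθ⟩ := hdet t
    obtain ⟨ρ, hρ⟩ := exists_real_det_eq hr hrε hx hv hw
    obtain ⟨hx1, hx2⟩ := hbd _ hz x hx hux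
    rw [hρ, hx1, hx2, hHW _ hz] at hcθ
    generalize Complex.exp (t * Complex.I) = z at *
    -- The real factor `ρ` may have either sign, but only its square enters. It is nonzero because
    -- the squared determinant is a positive multiple of an exponential.
    have hρ0 : ρ ≠ 0 := by
      rintro rfl
      apply mul_ne_zero (Complex.ofReal_ne_zero.2 hc.ne') (Complex.exp_ne_zero (θ t * Complex.I))
      rw [← hcθ]; simp
    refine ⟨c / ρ ^ 2, by positivity, ?_⟩
    have hρ0' : (ρ : ℂ) ≠ 0 := Complex.ofReal_ne_zero.2 hρ0
    push_cast
    rw [div_mul_eq_mul_div, eq_div_iff (pow_ne_zero 2 hρ0'), ← hcθ]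
    simp only [div_eq_mul_inv]
    ring
  -- Eliminating |S₁| - |T₁| from the two degree equations leaves |S₂| + |T₂| + 2|R| = 0, a sum of
  -- nonnegative terms.
  have hcards : Multiset.card T₂ = 0 ∧ Multiset.card S₂ = 0 ∧ Multiset.card R = 0 ∧
      Multiset.card S₁ = Multiset.card T₁ := by
    push_cast at hw hmas0
    omega
  obtain ⟨hT₂0, hS₂0, hR0, hST⟩ := hcards
  rw [Multiset.card_eq_zero] at hT₂0 hS₂0 hR0
  subst hT₂0 hS₂0 hR0
  have hHne : ∀ z ∈ closedBall (0 : ℂ) 1, H z ≠ 0 := fun z hz => by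
    rw [hHg z hz, rootProd_zero, mul_one]; exact hg0 z hz
  have hHeq : ∀ z, H z = P₁ z ^ 2 * G₂ z - ε * rootProd T₁ z ^ 2 := fun z => by
    simp [hH, hP₂]
  have hHnorm' : ∀ z ∈ sphere (0 : ℂ) 1, ‖H z‖ = r * ‖rootProd T₁ z ^ 2‖ := fun z hz => by
    have h1 := hHnorm z hz
    rw [rootProd_zero, mul_one, norm_div,
      div_eq_iff (norm_ne_zero_iff.2 (pow_ne_zero 2 (hQ₁ z hz)))] at h1
    exact h1
  -- The descent is applied to r/(w - ε) = r Q₁²/H with w = z₁² z₂. Its zeros are those of Q₁², and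
  -- r/(w - ε) + r/ε = r P₁² G₂/(ε H) vanishes exactly as P₁² does.
  have hT₁0 : T₁ = 0 := by
    have hu : ∀ z ∈ ball (0 : ℂ) 1, AnalyticAt ℂ (fun z => (r : ℂ) / H z) z := fun z hz =>
      analyticAt_const.div (hHD.analyticAt_of_mem hz) (hHne z (ball_subset_closedBall hz))
    have hF : DiffContOnCl ℂ (fun z => rootProd (2 • T₁) z * (r / H z)) (ball 0 1) :=
      (diffContOnCl_rootProd _).fun_mul (diffContOnCl_const.fun_div hHD hHne)
    refine eq_zero_of_two_even_fibres hF (c := -r / ε) (S := S₁) (fun z hz => ?_)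
      (div_ne_zero (neg_ne_zero.2 hr0) hε) ?_ hT₁ hS₁ (fun z hz => ?_) (fun z hz => ?_)
    · have h1 : ‖rootProd T₁ z ^ 2‖ ≠ 0 := norm_ne_zero_iff.2 (pow_ne_zero 2 (hQ₁ z hz))
      rw [rootProd_nsmul, norm_mul, norm_div, hHnorm' z hz, Complex.norm_real, Real.norm_eq_abs,
        abs_of_pos hr]
      field_simp
    · rw [norm_div, norm_neg, Complex.norm_real, Real.norm_eq_abs, abs_of_pos hr,
        div_lt_one (hr.trans hrε)]
      exact hrε
    · rw [analyticOrderAt_mul_of_ne_zero (analyticAt_rootProd _ z) (hu z hz)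
        (div_ne_zero hr0 (hHne z (ball_subset_closedBall hz))), analyticOrderAt_rootProd,
        Multiset.count_nsmul]
    · have hzc := ball_subset_closedBall hz
      have ha : AnalyticAt ℂ (fun z => G₁ z ^ 2 * G₂ z / ε * (r / H z)) z :=
        ((((hG₁.analyticAt_of_mem hz).pow 2).mul (hG₂.analyticAt_of_mem hz)).div analyticAt_const
          hε).mul (hu z hz)
      have h0 : G₁ z ^ 2 * G₂ z / ε * (r / H z) ≠ 0 :=
        mul_ne_zero (div_ne_zero (mul_ne_zero (pow_ne_zero 2 (hG₁0 z hzc)) (hG₂0 z hzc)) hε)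
          (div_ne_zero hr0 (hHne z hzc))
      rw [← Multiset.count_nsmul, ← analyticOrderAt_rootProd,
        ← analyticOrderAt_mul_of_ne_zero (analyticAt_rootProd _ z) ha h0]
      refine analyticOrderAt_congr ?_
      filter_upwards [isOpen_ball.mem_nhds hz] with x hx
      have hHx := hHne x (ball_subset_closedBall hx)
      rw [rootProd_nsmul, rootProd_nsmul]
      field_simp
      rw [hHeq x]
      simp only [hP₁]
      ring
  subst hT₁0
  rw [Multiset.card_zero, Multiset.card_eq_zero] at hST
  subst hST
  have hval : ∀ z ∈ closedBall (0 : ℂ) 1, u z = ((G₁ z : P1), (G₂ z : P1)) := by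
    intro z hz
    have h1 := (hL₁.2.2 z hz).2
    have h2 := (hL₂.2.2 z hz).2
    simp only [hP₁, hP₂, rootProd_zero, mul_one, P1.ofHom_one_right] at h1 h2
    exact Prod.ext h1 h2
  have hHconst := (hHD.eq_of_norm_sphere hHne (C := r)
    fun z hz => by simpa using hHnorm' z hz).2
  have hprod : ∀ z ∈ closedBall (0 : ℂ) 1, G₁ z ^ 2 * G₂ z = H 0 + ε := fun z hz => by
    rw [← hHconst z hz, hHeq]
    simp [hP₁]
  have h1s : (1 : ℂ) ∈ sphere (0 : ℂ) 1 := by simp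
  have hlam : ∀ z ∈ sphere (0 : ℂ) 1, ‖G₁ z‖ ^ 4 - ‖G₂ z‖ ^ 2 = lam := fun z hz => by
    have := (hmemL z hz).2
    simpa [hP₁, hP₂] using this
  -- On the boundary |z₁|² |z₂| and |z₁|⁴ - |z₂|² are both constant. A larger |z₁| would force a
  -- larger |z₂| by the second and thus a larger product.
  have hnorm : ∀ z ∈ sphere (0 : ℂ) 1, ‖G₁ z‖ = ‖G₁ 1‖ := by
    have hle : ∀ z ∈ sphere (0 : ℂ) 1, ∀ z' ∈ sphere (0 : ℂ) 1, ‖G₁ z‖ ≤ ‖G₁ z'‖ := by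
      intro z hz z' hz'
      by_contra! hlt
      have hp := (hprod z (sphere_subset_closedBall hz)).trans
        (hprod z' (sphere_subset_closedBall hz')).symm
      have hp' := congrArg norm hp
      rw [norm_mul, norm_mul, norm_pow, norm_pow] at hp'
      have e1 := hlam z hz
      have e2 := hlam z' hz'
      have hG1 : 0 < ‖G₁ z'‖ := norm_pos_iff.2 (hG₁0 z' (sphere_subset_closedBall hz'))
      have hG2 : 0 < ‖G₂ z'‖ := norm_pos_iff.2 (hG₂0 z' (sphere_subset_closedBall hz'))
      have hsq : ‖G₁ z'‖ ^ 2 < ‖G₁ z‖ ^ 2 := pow_lt_pow_left₀ hlt hG1.le two_ne_zero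
      have h4 : ‖G₁ z'‖ ^ 4 < ‖G₁ z‖ ^ 4 := pow_lt_pow_left₀ hlt hG1.le four_ne_zero
      have h5 : ‖G₂ z'‖ ^ 2 < ‖G₂ z‖ ^ 2 := by linarith
      have h6 : ‖G₂ z'‖ < ‖G₂ z‖ := lt_of_pow_lt_pow_left₀ 2 (norm_nonneg _) h5
      have := mul_lt_mul'' hsq h6 (by positivity) hG2.le
      linarith
    exact fun z hz => le_antisymm (hle z hz 1 h1s) (hle 1 h1s z hz)
  have hG₁c := (hG₁.eq_of_norm_sphere hG₁0 hnorm).2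
  have hconst : ∀ z ∈ closedBall (0 : ℂ) 1, u z = u 0 := by
    intro z hz
    have h0 : (0 : ℂ) ∈ closedBall (0 : ℂ) 1 := by simp
    have h1 := hprod z hz
    rw [hG₁c z hz, ← hprod 0 h0] at h1
    rw [hval z hz, hval 0 h0, hG₁c z hz,
      mul_left_cancel₀ (pow_ne_zero 2 (hG₁0 0 h0)) h1]
  exact hyy ((hconst y hy).trans (hconst y' hy').symm)

theorem mainTheorem11 :
    (∀ (ε : ℂ) (r : ℝ) (m : ℕ), 0 < r → r < ‖ε‖ → 1 ≤ m →
      ¬ ∃ ubar : ℂ → P1, P1.IsMeromorphicDisc ubar ∧ P1.MapsToComplementOfDisc ε r ubar ∧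
        P1.HasExactlyDoubleZeros ubar m ∧ P1.HasExactlyDoublePoles ubar m) ∧
    (∀ (ε : ℂ) (r lam : ℝ), 0 < r → r < ‖ε‖ →
      ¬ ∃ u : ℂ → P1 × P1, IsIndexZeroDisc (liftedChekanovTorus ε r lam) u) ∧
    (∀ ε : ℂ, ε ≠ 0 → walls ε = ∅) := by
  refine ⟨fun ε r m hr hrε hm => P1.not_exists_double_zeros_double_poles hr hrε hm,
    fun ε r lam hr hrε ⟨u, hu⟩ => not_isIndexZeroDisc hr hrε u hu, fun ε _ => ?_⟩
  rw [Set.eq_empty_iff_forall_notMem]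
  rintro ⟨r, lam⟩ ⟨hr, hrε, u, hu⟩
  exact not_isIndexZeroDisc hr hrε u hu
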